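/- Let $p_k$ denote the $k$-th prime number ($p_1=2$). For a Dirichlet series $\sum_{n\ge1}a_nn^{-s}$ let $\sigma_a$, $\sigma_b$, $\sigma_c\in[-\infty,\infty]$ be the infimum of the real $\sigma$ such that, on the half plane $\{\operatorname{Re}s>\sigma\}$, the series converges absolutely, converges to a bounded function, respectively converges (partial sums $\sum_{n\le N}a_nn^{-s}$ as $N\to\infty$). Let $\Lambda(n)$ be the number of prime factors of $n$ counted with multiplicity. Let $(\beta_L)_{L\ge1}$ be any complex numbers with $|\beta_L|=1$ (for example $\beta_L=1$ for all $L$). Define $$a_n=\beta_L\,2^{-3L/2}\,e^{2\pi i\,i_1i_2/2^L}\quad\text{if } n=p_{2\cdot2^L+i_1}\,p_{3\cdot 2^L+i_2}\text{ with } L\ge1,\ 0\le i_1,i_2<2^L,$$ and $a_n=0$ for all other $n$. These $a_n$ are well defined, and $\Lambda(n)=2$ whenever $a_n\ne0$, so the series $\sum a_nn^{-s}$ has homogeneity $2$. It satisfies $$\sigma_b=0,\qquad \sigma_a\ge\tfrac14,\qquad \sigma_c\le-\tfrac14,$$ and moreover $$\sigma_a-\sigma_b=\tfrac14,\qquad \sigma_b-\sigma_c\ge\tfrac14,$$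 so the series converges beyond its Bohr strip. The value $\frac14$ is optimal: every Dirichlet series $\sum a_nn^{-s}$ with $a_n=0$ whenever $\Lambda(n)>2$ satisfies $\sigma_a\le\sigma_b+\frac14$. -/

import Mathlib

open Filter Topology
open scoped ArithmeticFunction.Omega

/-- The ordinary Dirichlet series `∑_{n ≥ 1} a n * n ^ (-s)` converges (possibly only
conditionally, in the natural order of summation) to the value `l` at the point `s`. -/
def DirichletConvergesTo (a : ℕ → ℂ) (s l : ℂ) : Prop :=
  Tendsto (fun N : ℕ => ∑ n ∈ Finset.Icc 1 N, a n * (n : ℂ) ^ (-s)) atTop (𝓝 l)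

/-- The abscissa of convergence `σ_c`: the infimum of the real `σ` such that the series converges
at every `s` with `Re s > σ`. -/
noncomputable def abscissaOfConv (a : ℕ → ℂ) : EReal :=
  sInf (Real.toEReal '' {σ : ℝ | ∀ s : ℂ, σ < s.re → ∃ l : ℂ, DirichletConvergesTo a s l})

/-- The abscissa of boundedness `σ_b`: the infimum of the real `σ` such that the series converges
to a bounded function on the half plane `Re s > σ`. -/
noncomputable def abscissaOfBoundedness (a : ℕ → ℂ) : EReal :=
  sInf (Real.toEReal ''
    {σ : ℝ | ∃ C : ℝ, ∀ s : ℂ, σ < s.re → ∃ l : ℂ, DirichletConvergesTo a s l ∧ ‖l‖ ≤ C})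

/-- The `k`-th prime number for `k ≥ 1`, so that `kthPrime 1 = 2`, `kthPrime 2 = 3`. -/
noncomputable def kthPrime (k : ℕ) : ℕ := Nat.nth Nat.Prime (k - 1)

/-- The entry `ω ^ (i j)`, `ω = exp (2 π i / r)`, of the `r × r` Walsh matrix. -/
noncomputable def walshEntry (r i j : ℕ) : ℂ :=
  Complex.exp (2 * Real.pi * Complex.I / r) ^ (i * j)

/-- The integer `n = p_k p_k'` with `k = 2 * 2 ^ L + i` and `k' = 3 * 2 ^ L + j`. -/
noncomputable def blockProduct (L i j : ℕ) : ℕ :=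
  kthPrime (2 * 2 ^ L + i) * kthPrime (3 * 2 ^ L + j)

/-- The coefficients of the `2`-homogeneous Walsh series with unimodular weights `β`: for
`L ≥ 1` and `i, j < 2 ^ L`, the coefficient at `n = blockProduct L i j` is
`β L * 2 ^ (- 3 L / 2) * ω ^ (i j)` with `ω = exp (2 π i / 2 ^ L)`; all others are `0`.
A given `n` is `blockProduct L i j` for at most one triple `(L, i, j)`, and then `L ≤ n`, so the
sum below has at most one nonzero term. -/
noncomputable def walshCoeff (β : ℕ → ℂ) (n : ℕ) : ℂ :=
  ∑ L ∈ Finset.Icc 1 n, ∑ i ∈ Finset.range (2 ^ L), ∑ j ∈ Finset.range (2 ^ L),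
    if n = blockProduct L i j then
      β L * (((2 : ℝ) ^ (-(3 / 2 : ℝ) * (L : ℝ)) : ℝ) : ℂ) * walshEntry (2 ^ L) i j
    else 0

/-! ### Summation by parts for Dirichlet series -/

/-! Optimality. After a translation, let the series of `b` converge to a function `f` bounded by `C`
on a half plane `Re s > -η`. The mean over `t` of `f (it) * r ^ (it)` recovers the coefficient at a
positive rational `r` (zero if `r` is not an integer): this is clear on `Re s = 2`, and Cauchy's
theorem moves it to the imaginary axis. Integrating `f` against a Riesz product, a nonnegative
weight of mean one, bounds by `C` on a polydisc a multi-affine polynomial with the coefficients of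
`b` (`norm_quadForm_le`); homogeneity two makes it quadratic. Its linear part is bounded in `ℓ¹`.
For its bilinear part, random signs and Khinchine's inequality bound `∑ q, √(∑ p, ‖b (p * q)‖ ^ 2)`,
and Cauchy–Schwarz over `p < q` yields absolute convergence at `1 / 4`
(`summable_norm_mul_rpow_of_bounded`).

The Walsh series. Write `r = 2 ^ L`. Three sizes of the `r × r` Walsh matrix are compared, each
multiplied by the weight `r ^ (-3/2)`, and the primes in block `L` have size `r` up to exponents
arbitrarily close to one. The sum of absolute values is `r ^ 2`, so a block contributes about `r ^
(1/2 - 2σ)` to the absolute series, which forces `σ_a ≥ 1/4`. The bilinear norm on the polydisc is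
at most `r ^ (3/2)`, because the matrix is `√r` times a unitary; complete blocks are therefore `O(r
^ (-σ))` and `σ_b ≤ 0`. The sum over any staircase region is only `O(r log r)`, because its rows are
geometric sums; an incomplete block thus leaves an error near `r ^ (-1/2)`. Since `n` is about `r ^
2` there, the tails of `∑ a n` are nearly `n ^ (-1/4)`, and partial summation gives `σ_c ≤ -1/4`. -/

lemma sum_Icc_by_parts (R g : ℕ → ℂ) (N : ℕ) :
    ∑ n ∈ Finset.Icc 1 N, (R (n - 1) - R n) * g n =
      R 0 * g 1 - R N * g (N + 1) + ∑ n ∈ Finset.Icc 1 N, R n * (g (n + 1) - g n) := by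
  induction N with
  | zero => simp
  | succ N ih =>
    rw [Finset.sum_Icc_succ_top (by omega), ih, Finset.sum_Icc_succ_top (by omega)]
    simp only [Nat.add_sub_cancel]
    ring

/-- Mean value inequality on `[n, n + 1]`; the condition on `s.re` makes the derivative largest at
the left end. -/
lemma norm_natCast_cpow_sub_le (s : ℂ) (hs : -1 ≤ s.re) {n : ℕ} (hn : 1 ≤ n) :
    ‖((n + 1 : ℕ) : ℂ) ^ (-s) - (n : ℂ) ^ (-s)‖ ≤ ‖s‖ * (n : ℝ) ^ (-s.re - 1) := by
  by_cases h0 : s = 0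
  · simp [h0]
  have hn' : (0 : ℝ) < n := by exact_mod_cast hn
  have key := Convex.norm_image_sub_le_of_norm_hasDerivWithin_le (𝕜 := ℝ)
    (f := fun x : ℝ => (x : ℂ) ^ (-s)) (f' := fun x : ℝ => -s * (x : ℂ) ^ (-s - 1))
    (s := Set.Icc (n : ℝ) (n + 1)) (C := ‖s‖ * (n : ℝ) ^ (-s.re - 1))
    (x := n) (y := n + 1) ?_ ?_ (convex_Icc _ _) (by simp) (by simp)
  · simpa using key
  · intro x hx
    have hx0 : 0 < x := hn'.trans_le hx.1
    have := hasDerivAt_ofReal_cpow_const hx0.ne' (neg_ne_zero.2 h0)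
    exact this.hasDerivWithinAt
  · intro x hx
    have hx0 : 0 < x := hn'.trans_le hx.1
    rw [norm_mul, norm_neg, Complex.norm_cpow_eq_rpow_re_of_pos hx0]
    gcongr
    simp only [Complex.sub_re, Complex.neg_re, Complex.one_re]
    exact Real.rpow_le_rpow_of_nonpos hn' hx.1 (by linarith)

/-- Partial sums of a Dirichlet series on a half plane on which they are controlled by the
partial sums of the coefficients. -/
lemma norm_sum_Icc_mul_cpow_le {c : ℕ → ℂ} {M : ℝ}
    (hM : ∀ n, ‖∑ m ∈ Finset.Icc 1 n, c m‖ ≤ M) {η : ℝ} (hη : 0 < η) {w : ℂ} (hw : η ≤ w.re)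
    (N : ℕ) :
    ‖∑ n ∈ Finset.Icc 1 N, c n * (n : ℂ) ^ (-w)‖ ≤
      M + M * (‖w‖ * ∑' n : ℕ, (n : ℝ) ^ (-η - 1)) := by
  have hM0 : 0 ≤ M := (norm_nonneg _).trans (hM 0)
  set R : ℕ → ℂ := fun n => -∑ m ∈ Finset.Icc 1 n, c m with hR
  have hRn : ∀ n, ‖R n‖ ≤ M := fun n => by simpa [hR] using hM n
  have hc : ∀ n ∈ Finset.Icc 1 N, c n * (n : ℂ) ^ (-w) = (R (n - 1) - R n) * (n : ℂ) ^ (-w) := by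
    intro n hn
    obtain ⟨m, rfl⟩ : ∃ m, n = m + 1 := ⟨n - 1, by have := (Finset.mem_Icc.1 hn).1; omega⟩
    congr 1
    simp only [hR, Nat.add_sub_cancel]
    rw [Finset.sum_Icc_succ_top (by omega)]
    ring
  rw [Finset.sum_congr rfl hc, sum_Icc_by_parts R (fun n => (n : ℂ) ^ (-w))]
  have hR0 : R 0 = 0 := by simp [hR]
  have h1 : ‖((N + 1 : ℕ) : ℂ) ^ (-w)‖ ≤ 1 := by
    rw [Complex.norm_natCast_cpow_of_pos (by omega)]
    apply Real.rpow_le_one_of_one_le_of_nonpos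
    · exact_mod_cast Nat.succ_pos N
    · simp; linarith
  have hsum : Summable fun n : ℕ => (n : ℝ) ^ (-η - 1) :=
    Real.summable_nat_rpow.2 (by linarith)
  rw [hR0, zero_mul, zero_sub]
  refine (norm_add_le _ _).trans (add_le_add ?_ ?_)
  · rw [norm_neg, norm_mul]
    calc _ ≤ M * 1 := by gcongr; exact hRn N
      _ = M := mul_one M
  · calc _ ≤ ∑ n ∈ Finset.Icc 1 N, M * (‖w‖ * (n : ℝ) ^ (-η - 1)) := by
          refine norm_sum_le_of_le _ fun n hn => ?_
          have hn1 := (Finset.mem_Icc.1 hn).1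
          rw [norm_mul]
          have h2 := norm_natCast_cpow_sub_le w (by linarith) hn1
          have h3 : (n : ℝ) ^ (-w.re - 1) ≤ (n : ℝ) ^ (-η - 1) :=
            Real.rpow_le_rpow_of_exponent_le (by exact_mod_cast hn1) (by linarith)
          have := hRn n
          gcongr
          exact h2.trans (by gcongr)
      _ = M * (‖w‖ * ∑ n ∈ Finset.Icc 1 N, (n : ℝ) ^ (-η - 1)) := by
          simp only [Finset.mul_sum]
      _ ≤ _ := by
          gcongr
          exact hsum.sum_le_tsum _ fun n _ => by positivity

/-- A Dirichlet series whose coefficient sum has tails `O (n ^ (-θ))` converges for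
`Re s > -θ`. -/
lemma exists_dirichletConvergesTo_of_tail_le {a R : ℕ → ℂ} {C θ : ℝ}
    (ha : ∀ n, 1 ≤ n → a n = R (n - 1) - R n) (hR : ∀ n, 1 ≤ n → ‖R n‖ ≤ C * (n : ℝ) ^ (-θ))
    {s : ℂ} (hs : -θ < s.re) (hs1 : -1 ≤ s.re) : ∃ l, DirichletConvergesTo a s l := by
  have hC : 0 ≤ C := by simpa using (norm_nonneg _).trans (hR 1 le_rfl)
  have heq : ∀ N, ∑ n ∈ Finset.Icc 1 N, a n * (n : ℂ) ^ (-s) =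
      R 0 - R N * ((N + 1 : ℕ) : ℂ) ^ (-s) +
        ∑ n ∈ Finset.Icc 1 N, R n * (((n + 1 : ℕ) : ℂ) ^ (-s) - (n : ℂ) ^ (-s)) := by
    intro N
    have := sum_Icc_by_parts R (fun n => (n : ℂ) ^ (-s)) N
    simp only [Nat.cast_one, Complex.one_cpow, mul_one] at this
    rw [← this]
    exact Finset.sum_congr rfl fun n hn => by rw [ha n (Finset.mem_Icc.1 hn).1]
  set u : ℕ → ℂ := fun n => R n * (((n + 1 : ℕ) : ℂ) ^ (-s) - (n : ℂ) ^ (-s)) with hu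
  have hus : Summable fun n => u (n + 1) := by
    have hsum : Summable fun n : ℕ => C * ‖s‖ * ((n + 1 : ℕ) : ℝ) ^ (-θ - s.re - 1) :=
      ((summable_nat_add_iff 1).2 (Real.summable_nat_rpow.2 (by linarith))).mul_left _
    refine Summable.of_norm_bounded hsum fun n => ?_
    have hpos : (0 : ℝ) < ((n + 1 : ℕ) : ℝ) := by positivity
    calc ‖u (n + 1)‖ ≤ (C * ((n + 1 : ℕ) : ℝ) ^ (-θ)) * (‖s‖ * ((n + 1 : ℕ) : ℝ) ^ (-s.re - 1)) := by
          rw [hu, norm_mul]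
          gcongr
          · exact hR _ (by omega)
          · exact norm_natCast_cpow_sub_le s hs1 (by omega)
      _ = C * ‖s‖ * ((n + 1 : ℕ) : ℝ) ^ (-θ - s.re - 1) := by
          rw [show -θ - s.re - 1 = -θ + (-s.re - 1) by ring, Real.rpow_add hpos]
          ring
  have hbdry : Tendsto (fun N : ℕ => R N * ((N + 1 : ℕ) : ℂ) ^ (-s)) atTop (𝓝 0) := by
    have hlim : Tendsto (fun N : ℕ => (C * 2 ^ |s.re|) * (N : ℝ) ^ (-(θ + s.re))) atTop
        (𝓝 ((C * 2 ^ |s.re|) * 0)) :=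
      ((tendsto_rpow_neg_atTop (by linarith)).comp tendsto_natCast_atTop_atTop).const_mul _
    rw [mul_zero] at hlim
    refine squeeze_zero_norm' ?_ hlim
    filter_upwards [eventually_ge_atTop 1] with N hN
    have hN0 : (0 : ℝ) < N := by exact_mod_cast hN
    have hN1 : (1 : ℝ) ≤ N := by exact_mod_cast hN
    have h1 : ‖((N + 1 : ℕ) : ℂ) ^ (-s)‖ ≤ 2 ^ |s.re| * (N : ℝ) ^ (-s.re) := by
      rw [Complex.norm_natCast_cpow_of_pos (by omega), Complex.neg_re]
      have : ((N + 1 : ℕ) : ℝ) = (1 + 1 / N) * N := by push_cast; field_simp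
      rw [this, Real.mul_rpow (by positivity) hN0.le]
      gcongr
      calc (1 + 1 / (N : ℝ)) ^ (-s.re) ≤ (1 + 1 / (N : ℝ)) ^ |s.re| :=
            Real.rpow_le_rpow_of_exponent_le (by simp) (neg_le_abs _)
        _ ≤ 2 ^ |s.re| := by
            gcongr
            have : 1 / (N : ℝ) ≤ 1 := by rw [div_le_one hN0]; exact hN1
            linarith
    rw [norm_mul]
    calc _ ≤ (C * (N : ℝ) ^ (-θ)) * (2 ^ |s.re| * (N : ℝ) ^ (-s.re)) := by
          gcongr
          exact hR N hN
      _ = _ := by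
          rw [neg_add, Real.rpow_add hN0]
          ring
  refine ⟨R 0 - 0 + ∑' n, u (n + 1), ?_⟩
  unfold DirichletConvergesTo
  simp_rw [heq]
  refine (tendsto_const_nhds.sub hbdry).add ?_
  refine hus.hasSum.tendsto_sum_nat.congr fun N => ?_
  rw [Finset.range_eq_Ico, Finset.sum_Ico_add' u 0 N 1]
  rfl

/-! ### Mean values over the real line -/

/-- `g` is locally integrable and `(2 T)⁻¹ ∫_{-T}^T g` tends to `m`. -/
def HasMean (g : ℝ → ℂ) (m : ℂ) : Prop :=
  (∀ a b : ℝ, IntervalIntegrable g MeasureTheory.volume a b) ∧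
    Tendsto (fun T : ℝ => (2 * (T : ℂ))⁻¹ * ∫ t in -T..T, g t) atTop (𝓝 m)

lemma HasMean.add {g h : ℝ → ℂ} {m k : ℂ} (hg : HasMean g m) (hh : HasMean h k) :
    HasMean (fun t => g t + h t) (m + k) := by
  refine ⟨fun a b => (hg.1 a b).add (hh.1 a b), (hg.2.add hh.2).congr fun T => ?_⟩
  rw [intervalIntegral.integral_add (hg.1 _ _) (hh.1 _ _), mul_add]

lemma HasMean.const_mul {g : ℝ → ℂ} {m : ℂ} (hg : HasMean g m) (c : ℂ) :
    HasMean (fun t => c * g t) (c * m) := by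
  refine ⟨fun a b => (hg.1 a b).const_mul c, (hg.2.const_mul c).congr fun T => ?_⟩
  rw [intervalIntegral.integral_const_mul]
  ring

/-- Used with `h` a Riesz product: a nonnegative weight of mean one carries a pointwise bound over
to the mean. -/
lemma HasMean.norm_le {g : ℝ → ℂ} {m : ℂ} {h : ℝ → ℝ} {C : ℝ} (hg : HasMean g m)
    (hh : HasMean (fun t => (h t : ℂ)) 1) (hC : ∀ t, ‖g t‖ ≤ C * h t) : ‖m‖ ≤ C := by
  have hint : ∀ a b : ℝ, IntervalIntegrable h MeasureTheory.volume a b := fun a b => by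
    have := hh.1 a b
    rw [intervalIntegrable_iff] at this ⊢
    exact this.re
  have h1 : Tendsto (fun T : ℝ => (2 * T)⁻¹ * ∫ t in -T..T, h t) atTop (𝓝 1) := by
    have := (Complex.continuous_re.tendsto _).comp hh.2
    refine this.congr fun T => ?_
    simp only [Function.comp_apply]
    rw [intervalIntegral.integral_ofReal]
    norm_cast
  have h2 := (h1.const_mul C)
  rw [mul_one] at h2
  refine le_of_tendsto_of_tendsto hg.2.norm h2 ?_
  filter_upwards [eventually_gt_atTop 0] with T hT
  rw [norm_mul, norm_inv, norm_mul, Complex.norm_real, Real.norm_eq_abs, abs_of_pos hT,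
    Complex.norm_ofNat, mul_left_comm, ← intervalIntegral.integral_const_mul]
  gcongr
  exact intervalIntegral.norm_integral_le_of_norm_le (by linarith)
    (Eventually.of_forall fun t _ => hC t) ((hint _ _).const_mul C)

lemma norm_mean_exp_le (ρ T : ℝ) (hT : 0 < T) :
    ‖(2 * (T : ℂ))⁻¹ * ∫ t in -T..T, Complex.exp (ρ * t * Complex.I)‖ ≤ 1 := by
  have := intervalIntegral.norm_integral_le_of_norm_le_const (a := -T) (b := T) (C := 1)
    (f := fun t : ℝ => Complex.exp (ρ * t * Complex.I)) (fun t _ => by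
      rw [← Complex.ofReal_mul, Complex.norm_exp_ofReal_mul_I])
  rw [norm_mul, norm_inv, norm_mul, Complex.norm_real, Real.norm_eq_abs, abs_of_pos hT,
    Complex.norm_ofNat, inv_mul_le_iff₀ (by positivity)]
  refine this.trans ?_
  rw [abs_of_pos (by linarith)]
  linarith

lemma tendsto_mean_exp (ρ : ℝ) :
    Tendsto (fun T : ℝ => (2 * (T : ℂ))⁻¹ * ∫ t in -T..T, Complex.exp (ρ * t * Complex.I)) atTop
      (𝓝 (if ρ = 0 then 1 else 0)) := by
  split_ifs with h
  · subst h
    refine tendsto_const_nhds.congr' ?_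
    filter_upwards [eventually_gt_atTop 0] with T hT
    have : (T : ℂ) ≠ 0 := by exact_mod_cast hT.ne'
    simp
    field_simp
    norm_num
  · have hc : (ρ * Complex.I : ℂ) ≠ 0 := by simp [h]
    have hlim : Tendsto (fun T : ℝ => T⁻¹ * |ρ|⁻¹) atTop (𝓝 (0 * |ρ|⁻¹)) :=
      tendsto_inv_atTop_zero.mul_const _
    rw [zero_mul] at hlim
    refine squeeze_zero_norm' ?_ hlim
    filter_upwards [eventually_gt_atTop 0] with T hT
    have hfun : (fun t : ℝ => Complex.exp (ρ * t * Complex.I)) =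
        fun t : ℝ => Complex.exp (ρ * Complex.I * t) := by
      ext t; congr 1; ring
    have hn : ∀ x : ℝ, ‖Complex.exp (ρ * Complex.I * x)‖ = 1 := fun x => by
      rw [show (ρ * Complex.I * x : ℂ) = ((ρ * x : ℝ) : ℂ) * Complex.I by push_cast; ring,
        Complex.norm_exp_ofReal_mul_I]
    rw [hfun, integral_exp_mul_complex hc, norm_mul, norm_div, norm_inv, norm_mul, norm_mul,
      Complex.norm_real, Complex.norm_real, Complex.norm_I, Complex.norm_ofNat,
      Real.norm_eq_abs, Real.norm_eq_abs, abs_of_pos hT]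
    have h2 := norm_sub_le (Complex.exp (ρ * Complex.I * (T : ℝ)))
      (Complex.exp (ρ * Complex.I * ((-T : ℝ) : ℂ)))
    rw [hn, hn] at h2
    have hρ : 0 < |ρ| := abs_pos.2 h
    calc _ ≤ (2 * T)⁻¹ * ((1 + 1) / (|ρ| * 1)) := by gcongr
      _ = T⁻¹ * |ρ|⁻¹ := by field_simp; norm_num

/-- Only frequency zero survives averaging. Absolute summability lets dominated convergence exchange
the series first with the integral, then with the limit in `T`. -/
lemma hasMean_tsum_exp {c : ℕ → ℂ} (hc : Summable fun n => ‖c n‖) (ρ : ℕ → ℝ) :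
    HasMean (fun t => ∑' n, c n * Complex.exp (ρ n * t * Complex.I))
      (∑' n, c n * if ρ n = 0 then 1 else 0) := by
  have hn : ∀ n (t : ℝ), ‖c n * Complex.exp (ρ n * t * Complex.I)‖ = ‖c n‖ := fun n t => by
    rw [norm_mul, ← Complex.ofReal_mul, Complex.norm_exp_ofReal_mul_I, mul_one]
  have hcont : Continuous fun t : ℝ => ∑' n, c n * Complex.exp (ρ n * t * Complex.I) :=
    continuous_tsum (fun n => by fun_prop) hc fun n t => (hn n t).le
  refine ⟨fun a b => hcont.intervalIntegrable a b, ?_⟩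
  have hint : ∀ T : ℝ, (2 * (T : ℂ))⁻¹ * ∫ t in -T..T,
      ∑' n, c n * Complex.exp (ρ n * t * Complex.I) =
      ∑' n, c n * ((2 * (T : ℂ))⁻¹ * ∫ t in -T..T, Complex.exp (ρ n * t * Complex.I)) := by
    intro T
    have := intervalIntegral.hasSum_integral_of_dominated_convergence (a := -T) (b := T)
      (μ := MeasureTheory.volume)
      (F := fun n (t : ℝ) => c n * Complex.exp (ρ n * t * Complex.I))
      (f := fun t : ℝ => ∑' n, c n * Complex.exp (ρ n * t * Complex.I))
      (fun n _ => ‖c n‖) (fun n => Continuous.aestronglyMeasurable (by fun_prop))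
      (fun n => Eventually.of_forall fun t _ => (hn n t).le)
      (Eventually.of_forall fun t _ => hc)
      (intervalIntegrable_const)
      (Eventually.of_forall fun t _ => by
        refine (Summable.of_norm ?_).hasSum
        simpa only [hn] using hc)
    rw [← this.tsum_eq, ← tsum_mul_left]
    congr 1
    ext n
    rw [intervalIntegral.integral_const_mul]
    ring
  simp_rw [hint]
  refine tendsto_tsum_of_dominated_convergence hc
    (fun n => (tendsto_mean_exp (ρ n)).const_mul (c n)) ?_
  filter_upwards [eventually_gt_atTop 0] with T hT n
  rw [norm_mul]
  exact mul_le_of_le_one_right (norm_nonneg _) (norm_mean_exp_le _ _ hT)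

/-- The coefficients of a Dirichlet series, extended by zero to the rational numbers. -/
def ratCoeff (b : ℕ → ℂ) (r : ℚ) : ℂ := if r.den = 1 then b r.num.natAbs else 0

lemma ratCoeff_natCast (b : ℕ → ℂ) (n : ℕ) : ratCoeff b n = b n := by
  simp [ratCoeff]

/-- The mean value of `∑ b_n n ^ (-s) * r ^ s` on a vertical line in the half plane of absolute
convergence. -/
lemma hasMean_tsum_mul_cpow {b : ℕ → ℂ} (hb0 : b 0 = 0) {K : ℝ}
    (hb : Summable fun n : ℕ => ‖b n‖ * (n : ℝ) ^ (-K)) {r : ℚ} (hr : 0 < r) :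
    HasMean (fun t : ℝ => (∑' n : ℕ, b n * (n : ℂ) ^ (-(K + t * Complex.I))) *
      ((r : ℝ) : ℂ) ^ (K + t * Complex.I)) (ratCoeff b r) := by
  have hr' : (0 : ℝ) < r := by exact_mod_cast hr
  set c : ℕ → ℂ := fun n => b n * (n : ℂ) ^ (-(K : ℂ)) * ((r : ℝ) : ℂ) ^ (K : ℂ) with hcdef
  have hc : Summable fun n => ‖c n‖ := by
    refine (hb.mul_right (‖((r : ℝ) : ℂ) ^ (K : ℂ)‖)).congr fun n => ?_
    rcases Nat.eq_zero_or_pos n with rfl | hn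
    · simp [hcdef, hb0]
    · simp only [hcdef]
      rw [norm_mul, norm_mul, Complex.norm_natCast_cpow_of_pos hn]
      simp
  -- The `n`-th term oscillates with frequency `log r - log n`, which vanishes only for `n = r`; the
  -- spurious index `0`, where `Real.log 0 = 0`, is removed by `hb0`.
  have key := hasMean_tsum_exp hc fun n => Real.log r - Real.log n
  convert key using 1
  · ext t
    rw [← tsum_mul_right]
    congr 1
    ext n
    rcases Nat.eq_zero_or_pos n with rfl | hn
    · simp [hcdef, hb0]
    · have hnC : (n : ℂ) ≠ 0 := by exact_mod_cast hn.ne'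
      have hrC : ((r : ℝ) : ℂ) ≠ 0 := by exact_mod_cast hr'.ne'
      simp only [hcdef]
      rw [Complex.cpow_def_of_ne_zero hnC, Complex.cpow_def_of_ne_zero hrC,
        Complex.cpow_def_of_ne_zero hnC, Complex.cpow_def_of_ne_zero hrC, mul_assoc, mul_assoc,
        mul_assoc, ← Complex.exp_add, ← Complex.exp_add, ← Complex.exp_add,
        ← Complex.ofReal_log hr'.le, ← Complex.natCast_log]
      congr 2
      push_cast
      ring
  · have hlog : ∀ n : ℕ, 0 < n → (Real.log r - Real.log n = 0 ↔ r = (n : ℚ)) := by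
      intro n hn
      rw [sub_eq_zero]
      constructor
      · intro h
        have := Real.log_injOn_pos (Set.mem_Ioi.2 hr') (Set.mem_Ioi.2 (by exact_mod_cast hn)) h
        exact_mod_cast this
      · rintro rfl
        simp
    have h0 : c 0 = 0 := by simp [hcdef, hb0]
    by_cases hex : ∃ m : ℕ, r = m
    · obtain ⟨m, rfl⟩ := hex
      have hm : 0 < m := by exact_mod_cast hr
      rw [ratCoeff_natCast, tsum_eq_single m]
      · rw [if_pos ((hlog m hm).2 rfl), mul_one]
        simp only [hcdef]
        have hmC : (m : ℂ) ≠ 0 := by exact_mod_cast hm.ne'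
        rw [mul_assoc]
        norm_num
        rw [← Complex.cpow_add _ _ hmC]
        simp
      · intro n hn
        rcases Nat.eq_zero_or_pos n with rfl | hn0
        · simp [h0]
        · rw [if_neg, mul_zero]
          rw [hlog n hn0]
          exact_mod_cast hn.symm
    · have hden : r.den ≠ 1 := fun h => hex ⟨r.num.natAbs, by
        have h1 : ((r.num.natAbs : ℕ) : ℤ) = r.num := Int.natAbs_of_nonneg (Rat.num_pos.2 hr).le
        have h2 : ((r.num.natAbs : ℕ) : ℚ) = r.num := by rw [← Int.cast_natCast, h1]
        rw [h2]
        exact (Rat.den_eq_one_iff r).1 h |>.symm⟩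
      rw [ratCoeff, if_neg hden]
      symm
      refine (tsum_congr fun n => ?_).trans tsum_zero
      rcases Nat.eq_zero_or_pos n with rfl | hn0
      · simp [h0]
      · rw [if_neg, mul_zero]
        rw [hlog n hn0]
        exact fun h => hex ⟨n, h⟩

/-! ### Moving the line of integration -/

section ContourShift

variable {b : ℕ → ℂ} {f : ℂ → ℂ} {η C : ℝ}

/-- Continuous majorants for the partial sums of a Dirichlet series inside its half plane of
convergence. -/
lemma exists_norm_sum_Icc_le (hη : 0 < η) (hf : ∀ s : ℂ, -η < s.re → DirichletConvergesTo b s (f s)) :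
    ∃ A B : ℝ, ∀ s : ℂ, 0 ≤ s.re → ∀ N : ℕ,
      ‖∑ n ∈ Finset.Icc 1 N, b n * (n : ℂ) ^ (-s)‖ ≤ A + B * ‖s + (η / 2 : ℝ)‖ := by
  -- The partial sums at the interior point `-η / 2` are bounded; partial summation from there costs
  -- a factor linear in the distance to that point.
  have h0 : -η < ((-(η / 2) : ℝ) : ℂ).re := by rw [Complex.ofReal_re]; linarith
  obtain ⟨M, hM⟩ := (hf _ h0).norm.bddAbove_range
  have hM' : ∀ n, ‖∑ m ∈ Finset.Icc 1 n, b m * (m : ℂ) ^ (-((-(η / 2) : ℝ) : ℂ))‖ ≤ M :=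
    fun n => hM ⟨n, rfl⟩
  refine ⟨M, M * ∑' n : ℕ, (n : ℝ) ^ (-(η / 2) - 1), fun s hs N => ?_⟩
  have hw : η / 2 ≤ (s + (η / 2 : ℝ)).re := by
    rw [Complex.add_re, Complex.ofReal_re]
    linarith
  have := norm_sum_Icc_mul_cpow_le hM' (half_pos hη) hw N
  convert this using 1
  · congr 1
    refine Finset.sum_congr rfl fun n hn => ?_
    have hn0 : (n : ℂ) ≠ 0 := by
      have := (Finset.mem_Icc.1 hn).1
      exact_mod_cast (by omega : n ≠ 0)
    rw [mul_assoc, ← Complex.cpow_add _ _ hn0]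
    congr 2
    push_cast
    ring
  · ring

/-- Here `f` is known only as a pointwise limit, so its measurability and integrability along a path
are inherited from the continuous partial sums and their common majorant. -/
lemma tendsto_integral_sum_mul_cpow (hη : 0 < η)
    (hf : ∀ s : ℂ, -η < s.re → DirichletConvergesTo b s (f s)) {x : ℂ} (hx : x ≠ 0)
    {γ : ℝ → ℂ} (hγ : Continuous γ) {u v : ℝ} (hγ0 : ∀ t ∈ Set.uIoc u v, 0 ≤ (γ t).re) :
    IntervalIntegrable (fun t => f (γ t) * x ^ (γ t)) MeasureTheory.volume u v ∧
    Tendsto (fun N : ℕ => ∫ t in u..v,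
      (∑ n ∈ Finset.Icc 1 N, b n * (n : ℂ) ^ (-(γ t))) * x ^ (γ t)) atTop
      (𝓝 (∫ t in u..v, f (γ t) * x ^ (γ t))) := by
  obtain ⟨A, B, hAB⟩ := exists_norm_sum_Icc_le hη hf
  have hxc : Continuous fun t => x ^ (γ t) := hγ.const_cpow (Or.inl hx)
  have hFc : ∀ N : ℕ, Continuous fun t : ℝ =>
      (∑ n ∈ Finset.Icc 1 N, b n * (n : ℂ) ^ (-(γ t))) * x ^ (γ t) := fun N => by
    refine (continuous_finsetSum _ fun n hn => ?_).mul hxc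
    have hn0 : (n : ℂ) ≠ 0 := by
      have := (Finset.mem_Icc.1 hn).1
      exact_mod_cast (by omega : n ≠ 0)
    exact continuous_const.mul (hγ.neg.const_cpow (Or.inl hn0))
  have hbound : Continuous fun t => (A + B * ‖γ t + (η / 2 : ℝ)‖) * ‖x ^ (γ t)‖ := by fun_prop
  have hlim : ∀ t ∈ Set.uIoc u v, Tendsto (fun N : ℕ =>
      (∑ n ∈ Finset.Icc 1 N, b n * (n : ℂ) ^ (-(γ t))) * x ^ (γ t)) atTop
      (𝓝 (f (γ t) * x ^ (γ t))) := fun t ht =>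
    (hf (γ t) (by linarith [hγ0 t ht])).mul_const _
  have hle : ∀ N : ℕ, ∀ t ∈ Set.uIoc u v,
      ‖(∑ n ∈ Finset.Icc 1 N, b n * (n : ℂ) ^ (-(γ t))) * x ^ (γ t)‖ ≤
        (A + B * ‖γ t + (η / 2 : ℝ)‖) * ‖x ^ (γ t)‖ := fun N t ht => by
    rw [norm_mul]
    exact mul_le_mul_of_nonneg_right (hAB _ (hγ0 t ht) N) (norm_nonneg _)
  constructor
  · have hmeas : MeasureTheory.AEStronglyMeasurable (fun t => f (γ t) * x ^ (γ t))
        (MeasureTheory.volume.restrict (Set.uIoc u v)) := by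
      refine aestronglyMeasurable_of_tendsto_ae atTop
        (fun N => (hFc N).aestronglyMeasurable) ?_
      filter_upwards [MeasureTheory.ae_restrict_mem measurableSet_uIoc] with t ht using hlim t ht
    refine IntervalIntegrable.mono_fun' (hbound.intervalIntegrable u v) hmeas ?_
    filter_upwards [MeasureTheory.ae_restrict_mem measurableSet_uIoc] with t ht
    exact le_of_tendsto (hlim t ht).norm (Eventually.of_forall fun N => hle N t ht)
  · exact intervalIntegral.tendsto_integral_filter_of_dominated_convergence _
      (Eventually.of_forall fun N => (hFc N).aestronglyMeasurable)
      (Eventually.of_forall fun N => Eventually.of_forall (hle N))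
      (hbound.intervalIntegrable u v) (Eventually.of_forall hlim)

/-- Cauchy's theorem is applied to the entire partial sums and passed to the limit, so holomorphy of
`f` is never needed. -/
lemma integral_rect_eq_zero (hη : 0 < η)
    (hf : ∀ s : ℂ, -η < s.re → DirichletConvergesTo b s (f s)) {x : ℂ} (hx : x ≠ 0)
    {K : ℝ} (hK : 0 ≤ K) (T : ℝ) :
    (∫ t : ℝ in (0 : ℝ)..K, f (t + ((-T : ℝ) : ℂ) * Complex.I) * x ^ (t + ((-T : ℝ) : ℂ) * Complex.I)) -
      (∫ t : ℝ in (0 : ℝ)..K, f (t + (T : ℂ) * Complex.I) * x ^ (t + (T : ℂ) * Complex.I)) +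
      Complex.I * (∫ t : ℝ in -T..T, f (K + t * Complex.I) * x ^ (K + t * Complex.I)) -
      Complex.I * (∫ t : ℝ in -T..T, f (t * Complex.I) * x ^ (t * Complex.I)) = 0 := by
  set F : ℕ → ℂ → ℂ := fun N s => (∑ n ∈ Finset.Icc 1 N, b n * (n : ℂ) ^ (-s)) * x ^ s with hF
  have hFd : ∀ N, Differentiable ℂ (F N) := fun N => by
    refine Differentiable.mul (Differentiable.fun_sum fun n hn => ?_)
      (differentiable_id.const_cpow (Or.inl hx))
    have hn0 : (n : ℂ) ≠ 0 := by
      have := (Finset.mem_Icc.1 hn).1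
      exact_mod_cast (by omega : n ≠ 0)
    exact (differentiable_id.neg.const_cpow (Or.inl hn0)).const_mul _
  have h0 : ∀ N, (∫ t : ℝ in (0 : ℝ)..K, F N (t + ((-T : ℝ) : ℂ) * Complex.I)) -
      (∫ t : ℝ in (0 : ℝ)..K, F N (t + (T : ℂ) * Complex.I)) +
      Complex.I * (∫ t : ℝ in -T..T, F N (K + t * Complex.I)) -
      Complex.I * (∫ t : ℝ in -T..T, F N (t * Complex.I)) = 0 := fun N => by
    have := Complex.integral_boundary_rect_eq_zero_of_differentiableOn (F N)
      (((-T : ℝ) : ℂ) * Complex.I) (K + T * Complex.I) (hFd N).differentiableOn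
    simpa using this
  have hT : ∀ c : ℝ, ∀ t ∈ Set.uIoc 0 K, 0 ≤ ((t : ℂ) + (c : ℂ) * Complex.I).re :=
    fun c t ht => by
      rw [Set.uIoc_of_le hK] at ht
      simpa using ht.1.le
  have t1 := (tendsto_integral_sum_mul_cpow hη hf hx (u := 0) (v := K)
    (γ := fun t : ℝ => t + ((-T : ℝ) : ℂ) * Complex.I) (by fun_prop) (hT (-T))).2
  have t2 := (tendsto_integral_sum_mul_cpow hη hf hx (u := 0) (v := K)
    (γ := fun t : ℝ => t + (T : ℂ) * Complex.I) (by fun_prop) (hT T)).2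
  have t3 := (tendsto_integral_sum_mul_cpow hη hf hx (u := -T) (v := T)
    (γ := fun t : ℝ => K + (t : ℂ) * Complex.I) (by fun_prop) (by simp [hK])).2
  have t4 := (tendsto_integral_sum_mul_cpow hη hf hx (u := -T) (v := T)
    (γ := fun t : ℝ => (t : ℂ) * Complex.I) (by fun_prop) (by simp)).2
  have := ((t1.sub t2).add (t3.const_mul Complex.I)).sub (t4.const_mul Complex.I)
  exact tendsto_nhds_unique this (tendsto_const_nhds.congr fun N => (h0 N).symm)

/-- Mean values on the imaginary axis of a Dirichlet series which converges to a bounded function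
on a larger half plane. -/
lemma hasMean_mul_cpow (hη : 0 < η) (hb0 : b 0 = 0)
    (hf : ∀ s : ℂ, -η < s.re → DirichletConvergesTo b s (f s))
    (hC : ∀ s : ℂ, -η < s.re → ‖f s‖ ≤ C) {r : ℚ} (hr : 0 < r) :
    HasMean (fun t : ℝ => f (t * Complex.I) * ((r : ℝ) : ℂ) ^ (t * Complex.I)) (ratCoeff b r) := by
  have hr' : (0 : ℝ) < r := by exact_mod_cast hr
  have hx : ((r : ℝ) : ℂ) ≠ 0 := by exact_mod_cast hr'.ne'
  -- Convergence at `s = 0` bounds the coefficients, hence absolute convergence on `Re s = 2`.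
  obtain ⟨B, hB⟩ : ∃ B, ∀ n, ‖b n‖ ≤ B := by
    obtain ⟨M, hM⟩ := (hf 0 (by simpa using hη)).norm.bddAbove_range
    have hM' : ∀ N, ‖∑ n ∈ Finset.Icc 1 N, b n‖ ≤ M := fun N => by
      simpa using hM ⟨N, rfl⟩
    refine ⟨M + M, fun n => ?_⟩
    rcases Nat.eq_zero_or_pos n with rfl | hn
    · have := (norm_nonneg _).trans (hM' 0)
      simp [hb0, this]
    · obtain ⟨m, rfl⟩ : ∃ m, n = m + 1 := ⟨n - 1, by omega⟩
      have : b (m + 1) = ∑ n ∈ Finset.Icc 1 (m + 1), b n - ∑ n ∈ Finset.Icc 1 m, b n := by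
        rw [Finset.sum_Icc_succ_top (by omega)]
        ring
      rw [this]
      exact (norm_sub_le _ _).trans (add_le_add (hM' _) (hM' _))
  have hsum : Summable fun n : ℕ => ‖b n‖ * (n : ℝ) ^ (-(2 : ℝ)) := by
    refine Summable.of_nonneg_of_le (fun n => by positivity)
      (fun n => mul_le_mul_of_nonneg_right (hB n) (by positivity))
      ((Real.summable_nat_rpow.2 (by norm_num)).mul_left B)
  have hval : ∀ t : ℝ, ∑' n : ℕ, b n * (n : ℂ) ^ (-(((2 : ℝ) : ℂ) + t * Complex.I)) =
      f ((2 : ℝ) + t * Complex.I) := by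
    intro t
    have hs : Summable fun n : ℕ => b n * (n : ℂ) ^ (-(((2 : ℝ) : ℂ) + t * Complex.I)) := by
      refine Summable.of_norm (hsum.congr fun n => ?_)
      rcases Nat.eq_zero_or_pos n with rfl | hn
      · simp [hb0]
      · rw [norm_mul, Complex.norm_natCast_cpow_of_pos hn]
        simp
    refine tendsto_nhds_unique ?_ (hf _ (by simp; linarith))
    have := (tendsto_add_atTop_iff_nat 1).2 hs.hasSum.tendsto_sum_nat
    refine this.congr fun N => ?_
    rw [Finset.range_eq_Ico, Finset.sum_eq_sum_Ico_succ_bot (by omega)]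
    simp [hb0, Finset.Ico_add_one_right_eq_Icc]
  have hmean := hasMean_tsum_mul_cpow hb0 hsum hr
  simp only [hval] at hmean
  refine ⟨fun u v => (tendsto_integral_sum_mul_cpow hη hf hx (u := u) (v := v)
    (γ := fun t : ℝ => (t : ℂ) * Complex.I) (by fun_prop) (by simp)).1, ?_⟩
  set D : ℝ := C * (1 + (r : ℝ) ^ (2 : ℝ)) with hD
  have hC0 : 0 ≤ C := (norm_nonneg _).trans (hC 0 (by simpa using hη))
  have hhor : ∀ c : ℝ, ‖∫ t : ℝ in (0 : ℝ)..2,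
      f (t + (c : ℂ) * Complex.I) * ((r : ℝ) : ℂ) ^ (t + (c : ℂ) * Complex.I)‖ ≤ D * |2 - 0| := by
    intro c
    refine intervalIntegral.norm_integral_le_of_norm_le_const fun t ht => ?_
    rw [Set.uIoc_of_le (by norm_num)] at ht
    rw [norm_mul, Complex.norm_cpow_eq_rpow_re_of_pos hr', hD]
    have hre : ((t : ℂ) + (c : ℂ) * Complex.I).re = t := by simp
    rw [hre]
    have h1 : ‖f (t + (c : ℂ) * Complex.I)‖ ≤ C := hC _ (by rw [hre]; linarith [ht.1])
    gcongr
    rcases le_total (r : ℝ) 1 with h | h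
    · have := Real.rpow_le_one hr'.le h ht.1.le
      have h3 : 0 ≤ (r : ℝ) ^ (2 : ℝ) := by positivity
      linarith
    · have := Real.rpow_le_rpow_of_exponent_le h ht.2
      linarith
  -- The horizontal sides of the rectangle are bounded independently of `T`, so the factor `(2 *
  -- T)⁻¹` removes them.
  have hdiff : Tendsto (fun T : ℝ => (2 * (T : ℂ))⁻¹ *
      ((∫ t in -T..T, f (t * Complex.I) * ((r : ℝ) : ℂ) ^ (t * Complex.I)) -
        ∫ t in -T..T, f ((2 : ℝ) + t * Complex.I) * ((r : ℝ) : ℂ) ^ (((2 : ℝ) : ℂ) + t * Complex.I)))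
      atTop (𝓝 0) := by
    have hlim : Tendsto (fun T : ℝ => T⁻¹ * (2 * D)) atTop (𝓝 (0 * (2 * D))) :=
      tendsto_inv_atTop_zero.mul_const _
    rw [zero_mul] at hlim
    refine squeeze_zero_norm' ?_ hlim
    filter_upwards [eventually_gt_atTop 0] with T hT
    have hrect := integral_rect_eq_zero hη hf hx (K := 2) (by norm_num) T
    have e1 := hhor (-T)
    have e2 := hhor T
    set I1 := ∫ t : ℝ in (0 : ℝ)..2,
      f (t + ((-T : ℝ) : ℂ) * Complex.I) * ((r : ℝ) : ℂ) ^ (t + ((-T : ℝ) : ℂ) * Complex.I)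
    set I2 := ∫ t : ℝ in (0 : ℝ)..2,
      f (t + (T : ℂ) * Complex.I) * ((r : ℝ) : ℂ) ^ (t + (T : ℂ) * Complex.I)
    set J0 := ∫ t in -T..T, f (t * Complex.I) * ((r : ℝ) : ℂ) ^ (t * Complex.I)
    set J2 := ∫ t in -T..T, f ((2 : ℝ) + t * Complex.I) *
      ((r : ℝ) : ℂ) ^ (((2 : ℝ) : ℂ) + t * Complex.I)
    have hJ : J0 - J2 = -Complex.I * (I1 - I2) := by
      linear_combination Complex.I * hrect + (J0 - J2) * Complex.I_mul_I
    rw [hJ, norm_mul, norm_inv, norm_mul, norm_mul, norm_neg, Complex.norm_I, Complex.norm_real,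
      Complex.norm_ofNat, Real.norm_eq_abs, abs_of_pos hT]
    have e3 := norm_sub_le I1 I2
    norm_num at e1 e2
    calc (2 * T)⁻¹ * (1 * ‖I1 - I2‖) ≤ (2 * T)⁻¹ * (1 * (D * 2 + D * 2)) := by
          gcongr
          linarith
      _ = T⁻¹ * (2 * D) := by field_simp; ring
  have := hmean.2.add hdiff
  rw [add_zero] at this
  refine this.congr fun T => ?_
  ring

end ContourShift

/-! ### Riesz products -/

/-- The character `t ↦ r ^ (i t)`. -/
noncomputable def ratChar (r : ℚ) (t : ℝ) : ℂ := ((r : ℝ) : ℂ) ^ (t * Complex.I)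

lemma ratChar_mul {r s : ℚ} (hr : 0 < r) (hs : 0 < s) (t : ℝ) :
    ratChar (r * s) t = ratChar r t * ratChar s t := by
  unfold ratChar
  have hr' : (0 : ℝ) ≤ r := by exact_mod_cast hr.le
  have hs' : (0 : ℝ) ≤ s := by exact_mod_cast hs.le
  rw [Rat.cast_mul, Complex.ofReal_mul, Complex.mul_cpow_ofReal_nonneg hr' hs']

lemma ratChar_one (t : ℝ) : ratChar 1 t = 1 := by simp [ratChar]

lemma norm_ratChar {r : ℚ} (hr : 0 < r) (t : ℝ) : ‖ratChar r t‖ = 1 := by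
  have hr' : (0 : ℝ) < r := by exact_mod_cast hr
  rw [ratChar, Complex.norm_cpow_eq_rpow_re_of_pos hr']
  simp

lemma ratChar_inv {r : ℚ} (hr : 0 < r) (t : ℝ) :
    ratChar r⁻¹ t = (starRingEnd ℂ) (ratChar r t) := by
  have h1 : ratChar r⁻¹ t * ratChar r t = 1 := by
    rw [← ratChar_mul (inv_pos.2 hr) hr, inv_mul_cancel₀ hr.ne', ratChar_one]
  rw [eq_inv_of_mul_eq_one_left h1, Complex.inv_def, Complex.normSq_eq_norm_sq, norm_ratChar hr]
  simp

/-- A factor `1 + 2 Re (l n ^ (i t))` of a Riesz product. -/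
noncomputable def rieszFactor (n : ℕ) (l : ℂ) (t : ℝ) : ℂ :=
  1 + l * ratChar n t + (starRingEnd ℂ) l * ratChar (n : ℚ)⁻¹ t

lemma rieszFactor_eq_ofReal {n : ℕ} (hn : 0 < n) (l : ℂ) (t : ℝ) :
    rieszFactor n l t = ((1 + 2 * (l * ratChar n t).re : ℝ) : ℂ) := by
  have hn' : (0 : ℚ) < n := by exact_mod_cast hn
  rw [rieszFactor, ratChar_inv hn', ← map_mul, add_assoc, Complex.add_conj]
  push_cast
  ring

lemma one_add_two_mul_re_nonneg {n : ℕ} (hn : 0 < n) {l : ℂ} (hl : ‖l‖ ≤ 1 / 2) (t : ℝ) :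
    0 ≤ 1 + 2 * (l * ratChar n t).re := by
  have hn' : (0 : ℚ) < n := by exact_mod_cast hn
  have h1 := Complex.abs_re_le_norm (l * ratChar n t)
  rw [norm_mul, norm_ratChar hn', mul_one] at h1
  have := neg_le_of_abs_le h1
  linarith

section RieszProduct

variable {b : ℕ → ℂ} {F : ℝ → ℂ}

lemma ratCoeff_eq_zero {q : ℕ} [Fact q.Prime] {r : ℚ} (h : padicValRat q r < 0) :
    ratCoeff b r = 0 := by
  rw [ratCoeff, if_neg]
  intro hden
  rw [padicValRat_def, hden] at h
  simp at h
  omega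

lemma padicValRat_mul_zpow {p q : ℕ} [Fact q.Prime] (hp : p.Prime) (hpq : p ≠ q) {r : ℚ}
    (hr : r ≠ 0) (e : ℤ) : padicValRat q (r * (p : ℚ) ^ e) = padicValRat q r := by
  have hp0 : (p : ℚ) ≠ 0 := by exact_mod_cast hp.ne_zero
  rw [padicValRat.mul hr (zpow_ne_zero _ hp0), padicValRat.zpow, padicValRat.of_nat]
  have : Fact p.Prime := ⟨hp⟩
  rw [padicValNat_primes hpq.symm]
  simp

lemma hasMean_mul_rieszFactor {G : ℝ → ℂ} {r : ℚ} (hr : 0 < r) {n : ℕ} (hn : 0 < n) (l : ℂ)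
    {m₀ m₁ m₂ : ℂ} (h₀ : HasMean (fun t => ratChar r t * G t) m₀)
    (h₁ : HasMean (fun t => ratChar (r * n) t * G t) m₁)
    (h₂ : HasMean (fun t => ratChar (r * (n : ℚ)⁻¹) t * G t) m₂) :
    HasMean (fun t => ratChar r t * (rieszFactor n l t * G t))
      (m₀ + l * m₁ + (starRingEnd ℂ) l * m₂) := by
  have hn' : (0 : ℚ) < n := by exact_mod_cast hn
  convert (h₀.add (h₁.const_mul l)).add (h₂.const_mul ((starRingEnd ℂ) l)) using 2 with t
  rw [ratChar_mul hr hn', ratChar_mul hr (inv_pos.2 hn'), rieszFactor]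
  ring

/-- Factors at primes other than `q` do not change the `q`-adic valuation, so every frequency in the
expanded product stays a non-integer, where the coefficient is zero. -/
lemma hasMean_rieszProduct_of_padicValRat_neg
    (hF : ∀ r : ℚ, 0 < r → HasMean (fun t => F t * ratChar r t) (ratCoeff b r))
    (l : ℕ → ℂ) (e : ℕ) {q : ℕ} [Fact q.Prime] (S : Finset ℕ) (hS : ∀ p ∈ S, p.Prime)
    (hq : q ∉ S) : ∀ r : ℚ, 0 < r → padicValRat q r < 0 →
    HasMean (fun t => ratChar r t * ((∏ p ∈ S, rieszFactor (p ^ e) (l p) t) * F t)) 0 := by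
  induction S using Finset.induction_on with
  | empty =>
    intro r hr hv
    have := hF r hr
    rw [ratCoeff_eq_zero hv] at this
    convert this using 2 with t
    simp [mul_comm]
  | insert a S ha ih =>
    intro r hr hv
    have hap := hS a (Finset.mem_insert_self _ _)
    have ha0 : (0 : ℚ) < ((a ^ e : ℕ) : ℚ) := by exact_mod_cast pow_pos hap.pos e
    have ih' := ih (fun p hp => hS p (Finset.mem_insert_of_mem hp))
      (fun h => hq (Finset.mem_insert_of_mem h))
    have haq : a ≠ q := fun h => hq (h ▸ Finset.mem_insert_self _ _)
    have h1 := ih' (r * ((a ^ e : ℕ) : ℚ)) (mul_pos hr ha0) (by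
      have := padicValRat_mul_zpow (q := q) hap haq hr.ne' (e : ℤ)
      rw [zpow_natCast] at this
      push_cast
      rwa [this])
    have h2 := ih' (r * ((a ^ e : ℕ) : ℚ)⁻¹) (mul_pos hr (inv_pos.2 ha0)) (by
      have := padicValRat_mul_zpow (q := q) hap haq hr.ne' (-(e : ℤ))
      rw [zpow_neg, zpow_natCast] at this
      push_cast
      rwa [this])
    have := hasMean_mul_rieszFactor hr (pow_pos hap.pos e) (l a) (ih' r hr hv) h1 h2
    simp only [mul_zero, add_zero] at this
    convert this using 2 with t
    rw [Finset.prod_insert ha, mul_assoc]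

/-- The polynomial of degree two in the variables indexed by `S` whose coefficients are those of
a Dirichlet series at products of at most two of the numbers `p ^ e`. -/
noncomputable def quadForm (b : ℕ → ℂ) (e : ℕ) (S : Finset ℕ) (m : ℕ) (l : ℕ → ℂ) : ℂ :=
  b m + ∑ p ∈ S, l p * b (m * p ^ e) +
    2⁻¹ * ∑ p ∈ S, ∑ q ∈ S, if p = q then 0 else l p * l q * b (m * p ^ e * q ^ e)

/-- The polynomial is affine in the new variable; `h3` discards the cubic terms that the second
summand would produce. -/
lemma quadForm_insert (b : ℕ → ℂ) (e : ℕ) {S : Finset ℕ} {a : ℕ} (ha : a ∉ S) (m : ℕ)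
    (l : ℕ → ℂ)
    (h3 : ∀ p ∈ S, ∀ q ∈ S, b (m * a ^ e * p ^ e * q ^ e) = 0) :
    quadForm b e (insert a S) m l = quadForm b e S m l + l a * quadForm b e S (m * a ^ e) l := by
  have hne : ∀ p ∈ S, p ≠ a := fun p hp h => ha (h ▸ hp)
  have e1 : ∑ q ∈ S, (if a = q then 0 else l a * l q * b (m * a ^ e * q ^ e)) =
      l a * ∑ q ∈ S, l q * b (m * a ^ e * q ^ e) := by
    rw [Finset.mul_sum]
    exact Finset.sum_congr rfl fun q hq => by rw [if_neg (hne q hq).symm, mul_assoc]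
  have e2 : ∑ p ∈ S, (if p = a then 0 else l p * l a * b (m * p ^ e * a ^ e)) =
      l a * ∑ q ∈ S, l q * b (m * a ^ e * q ^ e) := by
    rw [Finset.mul_sum]
    exact Finset.sum_congr rfl fun q hq => by
      rw [if_neg (hne q hq), mul_right_comm m]
      ring
  have e3 : ∑ p ∈ S, ∑ q ∈ S, (if p = q then 0 else l p * l q * b (m * a ^ e * p ^ e * q ^ e)) =
      0 :=
    Finset.sum_eq_zero fun p hp => Finset.sum_eq_zero fun q hq => by
      rw [h3 p hp q hq]
      simp
  unfold quadForm
  rw [e3]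
  simp only [Finset.sum_insert ha, if_true, Finset.sum_add_distrib, e1, e2]
  ring

/-- Expanding the factor at a new prime `a` replaces `m` by `m`, `m * a ^ e` or `m / a ^ e`. As `a`
does not divide `m`, the last has negative `a`-adic valuation and contributes nothing; the other two
give the recursion of `quadForm_insert`. -/
lemma hasMean_rieszProduct
    (hF : ∀ r : ℚ, 0 < r → HasMean (fun t => F t * ratChar r t) (ratCoeff b r))
    (hb : ∀ n, 2 < Ω n → b n = 0) (l : ℕ → ℂ) {e : ℕ} (he : 1 ≤ e) (S : Finset ℕ)
    (hS : ∀ p ∈ S, p.Prime) : ∀ m : ℕ, 0 < m → (∀ p ∈ S, ¬ p ∣ m) →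
    HasMean (fun t => ratChar m t * ((∏ p ∈ S, rieszFactor (p ^ e) (l p) t) * F t))
      (quadForm b e S m l) := by
  induction S using Finset.induction_on with
  | empty =>
    intro m hm _
    have := hF m (by exact_mod_cast hm)
    rw [ratCoeff_natCast] at this
    convert this using 2 with t
    · simp [mul_comm]
    · simp [quadForm]
  | insert a S ha ih =>
    intro m hm hdvd
    have hap := hS a (Finset.mem_insert_self _ _)
    have hSp : ∀ p ∈ S, p.Prime := fun p hp => hS p (Finset.mem_insert_of_mem hp)
    have : Fact a.Prime := ⟨hap⟩
    have ha0 : (0 : ℚ) < ((a ^ e : ℕ) : ℚ) := by exact_mod_cast pow_pos hap.pos e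
    have hm0 : (0 : ℚ) < m := by exact_mod_cast hm
    have h0 := ih hSp m hm fun p hp => hdvd p (Finset.mem_insert_of_mem hp)
    have h1 := ih hSp (m * a ^ e) (mul_pos hm (pow_pos hap.pos e)) fun p hp hpd => by
      rcases (hSp p hp).dvd_mul.1 hpd with h | h
      · exact hdvd p (Finset.mem_insert_of_mem hp) h
      · have := (Nat.prime_dvd_prime_iff_eq (hSp p hp) hap).1 ((hSp p hp).dvd_of_dvd_pow h)
        exact ha (this ▸ hp)
    have h2 := hasMean_rieszProduct_of_padicValRat_neg hF l e S hSp ha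
      (m * ((a ^ e : ℕ) : ℚ)⁻¹) (mul_pos hm0 (inv_pos.2 ha0)) (by
        rw [padicValRat.mul hm0.ne' (inv_pos.2 ha0).ne', padicValRat.inv, padicValRat.of_nat,
          padicValRat.of_nat, padicValNat.prime_pow,
          padicValNat.eq_zero_of_not_dvd (hdvd a (Finset.mem_insert_self _ _))]
        simp
        omega)
    rw [Nat.cast_mul] at h1
    have := hasMean_mul_rieszFactor hm0 (pow_pos hap.pos e) (l a) h0 h1 h2
    rw [mul_zero, add_zero] at this
    rw [quadForm_insert b e ha]
    · convert this using 2 with t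
      rw [Finset.prod_insert ha, mul_assoc]
    · intro p hp q hq
      refine hb _ ?_
      have hpp := hSp p hp
      have hqp := hSp q hq
      have n1 := pow_ne_zero e hap.ne_zero
      have n2 := pow_ne_zero e hpp.ne_zero
      have n3 := pow_ne_zero e hqp.ne_zero
      rw [ArithmeticFunction.cardFactors_mul (mul_ne_zero (mul_ne_zero hm.ne' n1) n2) n3,
        ArithmeticFunction.cardFactors_mul (mul_ne_zero hm.ne' n1) n2,
        ArithmeticFunction.cardFactors_mul hm.ne' n1,
        ArithmeticFunction.cardFactors_apply_prime_pow hap,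
        ArithmeticFunction.cardFactors_apply_prime_pow hpp,
        ArithmeticFunction.cardFactors_apply_prime_pow hqp]
      omega

lemma hasMean_one_mul_ratChar {r : ℚ} (hr : 0 < r) :
    HasMean (fun t => 1 * ratChar r t) (ratCoeff (Pi.single 1 1) r) := by
  have h := hasMean_tsum_mul_cpow (b := Pi.single 1 1) (K := 0) (by simp)
    (by
      refine summable_of_ne_finset_zero (s := {1}) fun n hn => ?_
      rw [Finset.mem_singleton] at hn
      simp [hn]) hr
  convert h using 2 with t
  rw [tsum_eq_single 1 fun n hn => by simp [hn]]
  simp [ratChar]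

/-- A Dirichlet series of homogeneity at most two which is bounded by `C` yields a polynomial
which is bounded by `C` on the polydisc of radius `1 / 2`. -/
lemma norm_quadForm_le {C : ℝ} (hFC : ∀ t, ‖F t‖ ≤ C)
    (hF : ∀ r : ℚ, 0 < r → HasMean (fun t => F t * ratChar r t) (ratCoeff b r))
    (hb : ∀ n, 2 < Ω n → b n = 0) {l : ℕ → ℂ} (hl : ∀ p, ‖l p‖ ≤ 1 / 2) {e : ℕ} (he : 1 ≤ e)
    {S : Finset ℕ} (hS : ∀ p ∈ S, p.Prime) : ‖quadForm b e S 1 l‖ ≤ C := by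
  have hdvd : ∀ p ∈ S, ¬ p ∣ 1 := fun p hp h => (hS p hp).one_lt.ne' (Nat.dvd_one.1 h)
  have h1 := hasMean_rieszProduct hF hb l he S hS 1 one_pos hdvd
  -- The constant `1` is itself a Dirichlet series of homogeneity at most two; the same computation
  -- shows that the Riesz product has mean one.
  have h2 := hasMean_rieszProduct (F := fun _ => 1) (b := Pi.single 1 1)
    (fun r hr => hasMean_one_mul_ratChar hr) (fun n hn => by
      rw [Pi.single_eq_of_ne]
      rintro rfl
      simp at hn) l he S hS 1 one_pos hdvd
  have hq : quadForm (Pi.single 1 1) e S 1 l = 1 := by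
    have hpe : ∀ p ∈ S, p ^ e ≠ 1 := fun p hp => (Nat.one_lt_pow (by omega) (hS p hp).one_lt).ne'
    rw [quadForm, Finset.sum_eq_zero, Finset.sum_eq_zero]
    · simp
    · intro p hp
      refine Finset.sum_eq_zero fun q hq => ?_
      rw [Pi.single_eq_of_ne]
      · simp
      · intro h
        rw [one_mul] at h
        exact hpe p hp (Nat.eq_one_of_mul_eq_one_right h)
    · intro p hp
      rw [one_mul, Pi.single_eq_of_ne (hpe p hp), mul_zero]
  rw [hq] at h2
  have hprod : ∀ t, ∏ p ∈ S, rieszFactor (p ^ e) (l p) t =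
      ((∏ p ∈ S, (1 + 2 * (l p * ratChar (p ^ e : ℕ) t).re) : ℝ) : ℂ) := fun t => by
    rw [Complex.ofReal_prod]
    exact Finset.prod_congr rfl fun p hp => rieszFactor_eq_ofReal (pow_pos (hS p hp).pos e) _ _
  have hnn : ∀ t, 0 ≤ ∏ p ∈ S, (1 + 2 * (l p * ratChar (p ^ e : ℕ) t).re) := fun t =>
    Finset.prod_nonneg fun p hp => one_add_two_mul_re_nonneg (pow_pos (hS p hp).pos e) (hl p) t
  simp only [Nat.cast_one, ratChar_one, one_mul, mul_one, hprod] at h1 h2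
  refine h1.norm_le h2 fun t => ?_
  rw [norm_mul, Complex.norm_real, Real.norm_eq_abs, abs_of_nonneg (hnn t), mul_comm]
  exact mul_le_mul_of_nonneg_right (hFC t) (hnn t)

end RieszProduct

/-! ### The Khinchine inequality for the first moment -/

/-- The sum `∑ ± c` over `s` with the sign `+` exactly on `A`. -/
noncomputable def signSum {ι : Type*} [DecidableEq ι] (s A : Finset ι) (c : ι → ℂ) : ℂ :=
  ∑ i ∈ s, (if i ∈ A then 1 else -1) * c i

section Khinchine

variable {ι : Type*} [DecidableEq ι]

lemma signSum_insert_of_notMem {s A : Finset ι} {a : ι} (ha : a ∉ s) (haA : a ∉ A) (c : ι → ℂ) :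
    signSum (insert a s) A c = signSum s A c - c a := by
  rw [signSum, Finset.sum_insert ha, if_neg haA, signSum]
  ring

lemma signSum_insert_insert {s A : Finset ι} {a : ι} (ha : a ∉ s) (c : ι → ℂ) :
    signSum (insert a s) (insert a A) c = signSum s A c + c a := by
  rw [signSum, Finset.sum_insert ha, if_pos (Finset.mem_insert_self _ _), signSum, one_mul,
    add_comm]
  congr 1
  refine Finset.sum_congr rfl fun i hi => ?_
  have : i ≠ a := fun h => ha (h ▸ hi)
  simp [this]

lemma sum_powerset_insert_signSum {s : Finset ι} {a : ι} (ha : a ∉ s) (c : ι → ℂ) (φ : ℂ → ℝ) :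
    ∑ A ∈ (insert a s).powerset, φ (signSum (insert a s) A c) =
      ∑ A ∈ s.powerset, (φ (signSum s A c - c a) + φ (signSum s A c + c a)) := by
  rw [Finset.sum_powerset_insert ha, Finset.sum_add_distrib]
  congr 1
  · refine Finset.sum_congr rfl fun A hA => ?_
    rw [signSum_insert_of_notMem ha fun h => ha (Finset.mem_powerset.1 hA h)]
  · exact Finset.sum_congr rfl fun A _ => by rw [signSum_insert_insert ha]

lemma sum_norm_signSum_sq (s : Finset ι) (c : ι → ℂ) :
    ∑ A ∈ s.powerset, ‖signSum s A c‖ ^ 2 = 2 ^ s.card * ∑ i ∈ s, ‖c i‖ ^ 2 := by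
  induction s using Finset.induction_on with
  | empty => simp [signSum]
  | insert a s ha ih =>
    rw [sum_powerset_insert_signSum ha c (fun z => ‖z‖ ^ 2)]
    have : ∀ z w : ℂ, ‖z - w‖ ^ 2 + ‖z + w‖ ^ 2 = 2 * ‖z‖ ^ 2 + 2 * ‖w‖ ^ 2 := fun z w => by
      have := parallelogram_law_with_norm ℝ z w
      nlinarith
    simp only [this, Finset.sum_add_distrib, ← Finset.mul_sum, ih, Finset.sum_const,
      Finset.card_powerset, Finset.card_insert_of_notMem ha, Finset.sum_insert ha, nsmul_eq_mul]
    push_cast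
    ring

/-- The left side is `2 (|z|² + |w|²)² + 8 (Re z w̄)²`; Cauchy–Schwarz on the last term turns the
mixed coefficient into `4 + 8 = 12`. -/
lemma norm_sub_pow_four_add (z w : ℂ) :
    ‖z - w‖ ^ 4 + ‖z + w‖ ^ 4 ≤ 2 * ‖z‖ ^ 4 + 12 * (‖z‖ ^ 2 * ‖w‖ ^ 2) + 2 * ‖w‖ ^ 4 := by
  have h4 : ∀ u : ℂ, ‖u‖ ^ 4 = (u.re ^ 2 + u.im ^ 2) ^ 2 := fun u => by
    rw [show (4 : ℕ) = 2 * 2 by norm_num, pow_mul, Complex.sq_norm, Complex.normSq_apply]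
    ring
  simp only [h4, Complex.sq_norm, Complex.normSq_apply, Complex.sub_re, Complex.sub_im,
    Complex.add_re, Complex.add_im]
  nlinarith [sq_nonneg (z.re * w.im - z.im * w.re)]

lemma sum_norm_signSum_pow_four_le (s : Finset ι) (c : ι → ℂ) :
    ∑ A ∈ s.powerset, ‖signSum s A c‖ ^ 4 ≤ 3 * 2 ^ s.card * (∑ i ∈ s, ‖c i‖ ^ 2) ^ 2 := by
  induction s using Finset.induction_on with
  | empty => simp [signSum]
  | insert a s ha ih =>
    rw [sum_powerset_insert_signSum ha c (fun z => ‖z‖ ^ 4)]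
    refine (Finset.sum_le_sum fun A _ => norm_sub_pow_four_add _ _).trans ?_
    simp only [Finset.sum_add_distrib, ← Finset.mul_sum, ← Finset.sum_mul, sum_norm_signSum_sq,
      Finset.sum_const, Finset.card_powerset, Finset.card_insert_of_notMem ha,
      Finset.sum_insert ha, nsmul_eq_mul]
    push_cast
    have h2 : (0 : ℝ) ≤ 2 ^ s.card * (‖c a‖ ^ 2) ^ 2 := by positivity
    rw [pow_succ (2 : ℝ) s.card]
    nlinarith

/-- The Khinchine inequality between the first and the second moment. -/
lemma sqrt_sum_sq_le_sum_norm_signSum (s : Finset ι) (c : ι → ℂ) :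
    2 ^ s.card * √(∑ i ∈ s, ‖c i‖ ^ 2) ≤ 9 / 5 * ∑ A ∈ s.powerset, ‖signSum s A c‖ := by
  set V := ∑ i ∈ s, ‖c i‖ ^ 2 with hV
  have hV0 : 0 ≤ V := Finset.sum_nonneg fun i _ => by positivity
  rcases hV0.eq_or_lt with h0 | hpos
  · rw [← h0, Real.sqrt_zero, mul_zero]
    positivity
  set σ := √V with hσ
  have hσ0 : 0 < σ := Real.sqrt_pos.2 hpos
  have hσV : σ ^ 2 = V := Real.sq_sqrt hV0
  -- With `u = t / σ` this reads `u - 4/27 u³ ≤ 1`, with equality at `u = 3/2`. Summing with the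
  -- fourth moment bound `3 σ⁴` leaves `1 - 12/27 = 5/9`, whence the constant `9/5`.
  have hpt : ∀ t : ℝ, 0 ≤ t → t ^ 2 * σ ^ 2 - 4 / 27 * t ^ 4 ≤ t * σ ^ 3 := fun t ht => by
    have : 0 ≤ 4 / 27 * (t * ((t - 3 / 2 * σ) ^ 2 * (t + 3 * σ))) := by positivity
    nlinarith
  have hsum : ∑ A ∈ s.powerset, (‖signSum s A c‖ ^ 2 * σ ^ 2 - 4 / 27 * ‖signSum s A c‖ ^ 4) ≤
      ∑ A ∈ s.powerset, ‖signSum s A c‖ * σ ^ 3 :=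
    Finset.sum_le_sum fun A _ => hpt _ (norm_nonneg _)
  rw [Finset.sum_sub_distrib, ← Finset.sum_mul, ← Finset.sum_mul, ← Finset.mul_sum,
    sum_norm_signSum_sq, ← hV, ← hσV] at hsum
  have h4 := sum_norm_signSum_pow_four_le s c
  rw [← hV, ← hσV] at h4
  have hσ3 : 0 < σ ^ 3 := by positivity
  refine le_of_mul_le_mul_right ?_ hσ3
  nlinarith

end Khinchine

/-! ### Dirichlet series of homogeneity at most two -/

lemma exists_phase (z : ℂ) : ∃ u : ℂ, ‖u‖ ≤ 1 ∧ u * z = ‖z‖ := by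
  rcases eq_or_ne z 0 with rfl | hz
  · exact ⟨0, by simp⟩
  · have hz' : (‖z‖ : ℂ) ≠ 0 := by exact_mod_cast norm_ne_zero_iff.2 hz
    refine ⟨(starRingEnd ℂ) z / ‖z‖, ?_, ?_⟩
    · rw [norm_div, Complex.norm_conj, Complex.norm_real, norm_norm,
        div_self (norm_ne_zero_iff.2 hz)]
    · rw [div_mul_eq_mul_div, Complex.conj_mul', sq, mul_div_assoc, div_self hz', mul_one]

/-- Duality of `ℓ¹` and `ℓ^∞`: take for `u` the conjugate phases of `z`. -/
lemma sum_norm_le_of_forall_norm_sum_le {ι : Type*} (S : Finset ι) (z : ι → ℂ) {K : ℝ}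
    (h : ∀ u : ι → ℂ, (∀ i, ‖u i‖ ≤ 1) → ‖∑ i ∈ S, u i * z i‖ ≤ K) : ∑ i ∈ S, ‖z i‖ ≤ K := by
  choose u hu huz using fun i => exists_phase (z i)
  have := h u hu
  simp only [huz] at this
  rw [← Complex.ofReal_sum, Complex.norm_real, Real.norm_eq_abs] at this
  exact (le_abs_self _).trans this

section QuadForm

variable {b : ℕ → ℂ} {C : ℝ} {e : ℕ} {S : Finset ℕ}

/-- The odd part of the polynomial is its linear part, and `± u / 2` lie in the polydisc of radius
`1 / 2`. -/
lemma sum_norm_linear_le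
    (hQ : ∀ l : ℕ → ℂ, (∀ p, ‖l p‖ ≤ 1 / 2) → ‖quadForm b e S 1 l‖ ≤ C) :
    ∑ p ∈ S, ‖b (p ^ e)‖ ≤ 2 * C := by
  refine sum_norm_le_of_forall_norm_sum_le _ _ fun u hu => ?_
  have hl : ∀ p, ‖u p / 2‖ ≤ 1 / 2 := fun p => by
    rw [norm_div, Complex.norm_ofNat]
    linarith [hu p]
  have h1 := hQ (fun p => u p / 2) hl
  have h2 := hQ (fun p => -(u p / 2)) fun p => by rw [norm_neg]; exact hl p
  have heq : ∑ p ∈ S, u p * b (p ^ e) =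
      quadForm b e S 1 (fun p => u p / 2) - quadForm b e S 1 (fun p => -(u p / 2)) := by
    simp only [quadForm, mul_neg, neg_neg, neg_mul, Finset.sum_neg_distrib, one_mul,
      div_mul_eq_mul_div, ← Finset.sum_div]
    ring
  rw [heq]
  exact (norm_sub_le _ _).trans (by linarith)

/-- The second difference cancels the constant and linear parts and leaves the symmetric bilinear
form. -/
lemma quadForm_polarization (x y : ℕ → ℂ) :
    quadForm b 1 S 1 (fun p => x p + y p) - quadForm b 1 S 1 x - quadForm b 1 S 1 y +
      quadForm b 1 S 1 (fun _ => 0) =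
    ∑ q ∈ S, y q * ∑ p ∈ S, x p * if p = q then 0 else b (p * q) := by
  have h1 : ∑ p ∈ S, ∑ q ∈ S, (if p = q then 0 else (x p + y p) * (x q + y q) * b (p * q)) =
      ∑ p ∈ S, ∑ q ∈ S, (if p = q then 0 else x p * x q * b (p * q)) +
      ∑ p ∈ S, ∑ q ∈ S, (if p = q then 0 else y p * y q * b (p * q)) +
      (∑ q ∈ S, y q * ∑ p ∈ S, x p * (if p = q then 0 else b (p * q)) +
        ∑ q ∈ S, y q * ∑ p ∈ S, x p * if p = q then 0 else b (p * q)) := by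
    have h2 : ∑ q ∈ S, y q * ∑ p ∈ S, x p * (if p = q then 0 else b (p * q)) =
        ∑ p ∈ S, ∑ q ∈ S, (if p = q then 0 else x p * y q * b (p * q)) := by
      rw [Finset.sum_comm]
      refine Finset.sum_congr rfl fun q _ => ?_
      rw [Finset.mul_sum]
      refine Finset.sum_congr rfl fun p _ => ?_
      split_ifs <;> ring
    have h3 : ∑ q ∈ S, y q * ∑ p ∈ S, x p * (if p = q then 0 else b (p * q)) =
        ∑ p ∈ S, ∑ q ∈ S, (if p = q then 0 else y p * x q * b (p * q)) := by
      refine Finset.sum_congr rfl fun q _ => ?_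
      rw [Finset.mul_sum]
      refine Finset.sum_congr rfl fun p _ => ?_
      rw [mul_comm p q]
      by_cases h : p = q
      · simp [h]
      · rw [if_neg h, if_neg (Ne.symm h)]
        ring
    nth_rewrite 1 [h2]
    rw [h3]
    simp only [← Finset.sum_add_distrib]
    refine Finset.sum_congr rfl fun p _ => Finset.sum_congr rfl fun q _ => ?_
    split_ifs <;> ring
  have h4 : ∑ p ∈ S, (x p + y p) * b p = ∑ p ∈ S, x p * b p + ∑ p ∈ S, y p * b p := by
    simp only [add_mul, Finset.sum_add_distrib]
  simp only [quadForm, one_mul, pow_one, zero_mul, ite_self, Finset.sum_const_zero, mul_zero, h1,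
    h4]
  ring

lemma sum_norm_bilinear_le
    (hQ : ∀ l : ℕ → ℂ, (∀ p, ‖l p‖ ≤ 1 / 2) → ‖quadForm b 1 S 1 l‖ ≤ C)
    {x : ℕ → ℂ} (hx : ∀ p, ‖x p‖ ≤ 1) :
    ∑ q ∈ S, ‖∑ p ∈ S, x p * if p = q then 0 else b (p * q)‖ ≤ 64 * C := by
  refine sum_norm_le_of_forall_norm_sum_le _ _ fun y hy => ?_
  have hq : ∀ z : ℂ, ‖z‖ ≤ 1 → ‖z / 4‖ ≤ 1 / 4 := fun z hz => by
    rw [norm_div, Complex.norm_ofNat]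
    linarith
  -- Quarters keep the sum within radius `1 / 2`; undoing them costs `16`, and polarization has four
  -- terms, so the bound is `64 * C`.
  have h1 := hQ (fun p => x p / 4 + y p / 4) fun p =>
    (norm_add_le _ _).trans (by linarith [hq _ (hx p), hq _ (hy p)])
  have h2 := hQ (fun p => x p / 4) fun p => (hq _ (hx p)).trans (by norm_num)
  have h3 := hQ (fun p => y p / 4) fun p => (hq _ (hy p)).trans (by norm_num)
  have h4 := hQ (fun _ => 0) fun p => by norm_num
  have heq : ∑ q ∈ S, y q * ∑ p ∈ S, x p * (if p = q then 0 else b (p * q)) =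
      16 * ∑ q ∈ S, y q / 4 * ∑ p ∈ S, x p / 4 * if p = q then 0 else b (p * q) := by
    rw [Finset.mul_sum]
    refine Finset.sum_congr rfl fun q _ => ?_
    simp only [div_mul_eq_mul_div, ← Finset.sum_div]
    ring
  rw [heq, ← quadForm_polarization, norm_mul, Complex.norm_ofNat]
  set q1 := quadForm b 1 S 1 (fun p => x p / 4 + y p / 4)
  set q2 := quadForm b 1 S 1 (fun p => x p / 4)
  set q3 := quadForm b 1 S 1 (fun p => y p / 4)
  have e1 := norm_add_le (q1 - q2 - q3) (quadForm b 1 S 1 fun _ => 0)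
  have e2 := norm_sub_le (q1 - q2) q3
  have e3 := norm_sub_le q1 q2
  linarith

/-- Littlewood's mixed inequality: average the bilinear bound over all signs `x p = ± 1` and apply
Khinchine's inequality for each `q`. -/
lemma sum_sqrt_sum_sq_le
    (hQ : ∀ l : ℕ → ℂ, (∀ p, ‖l p‖ ≤ 1 / 2) → ‖quadForm b 1 S 1 l‖ ≤ C) :
    ∑ q ∈ S, √(∑ p ∈ S, ‖if p = q then 0 else b (p * q)‖ ^ 2) ≤ 9 / 5 * (64 * C) := by
  have h1 : 2 ^ S.card * ∑ q ∈ S, √(∑ p ∈ S, ‖if p = q then 0 else b (p * q)‖ ^ 2) ≤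
      2 ^ S.card * (9 / 5 * (64 * C)) := by
    rw [Finset.mul_sum]
    calc _ ≤ ∑ q ∈ S, 9 / 5 * ∑ A ∈ S.powerset,
            ‖signSum S A fun p => if p = q then 0 else b (p * q)‖ :=
          Finset.sum_le_sum fun q _ => sqrt_sum_sq_le_sum_norm_signSum _ _
      _ = 9 / 5 * ∑ A ∈ S.powerset, ∑ q ∈ S,
            ‖signSum S A fun p => if p = q then 0 else b (p * q)‖ := by
          rw [← Finset.mul_sum, Finset.sum_comm]
      _ ≤ 9 / 5 * ∑ A ∈ S.powerset, 64 * C := by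
          gcongr with A _
          refine sum_norm_bilinear_le hQ fun p => ?_
          split_ifs <;> simp
      _ = _ := by
          rw [Finset.sum_const, Finset.card_powerset, nsmul_eq_mul]
          push_cast
          ring
  exact le_of_mul_le_mul_left h1 (by positivity)

end QuadForm

lemma sum_Icc_inv_sqrt_le (N : ℕ) : ∑ m ∈ Finset.Icc 1 N, (√(m : ℝ))⁻¹ ≤ 2 * √(N : ℝ) := by
  induction N with
  | zero => simp
  | succ N ih =>
    rw [Finset.sum_Icc_succ_top (by omega)]
    have h0 : (0 : ℝ) ≤ N := by positivity
    have h1 : √((N + 1 : ℕ) : ℝ) ^ 2 = N + 1 := by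
      rw [Real.sq_sqrt (by positivity)]
      push_cast
      ring
    have h2 : √(N : ℝ) ^ 2 = N := Real.sq_sqrt h0
    have h3 : 0 < √((N + 1 : ℕ) : ℝ) := Real.sqrt_pos.2 (by positivity)
    have h4 := Real.sqrt_nonneg (N : ℝ)
    have h5 : (√((N + 1 : ℕ) : ℝ))⁻¹ ≤ 2 * √((N + 1 : ℕ) : ℝ) - 2 * √(N : ℝ) := by
      rw [inv_le_iff_one_le_mul₀ h3]
      nlinarith [sq_nonneg (√((N + 1 : ℕ) : ℝ) - √(N : ℝ))]
    linarith

/-- Cauchy–Schwarz in the smaller index: `∑ p ^ (-1/2)` over `p < q` is at most `2 √q`, and its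
square root is cancelled by `q ^ (-1/4)` up to `√2`. This fixes the exponent `1 / 4`. -/
lemma sum_lt_mul_rpow_le (S : Finset ℕ) (hS : ∀ p ∈ S, 0 < p) (β : ℕ → ℕ → ℂ) :
    ∑ q ∈ S, ∑ p ∈ S with p < q, ‖β p q‖ * ((p * q : ℕ) : ℝ) ^ (-(1 / 4) : ℝ) ≤
      √2 * ∑ q ∈ S, √(∑ p ∈ S, ‖if p = q then 0 else β p q‖ ^ 2) := by
  rw [Finset.mul_sum]
  refine Finset.sum_le_sum fun q hq => ?_
  have hq0 : (0 : ℝ) < q := by exact_mod_cast hS q hq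
  have h1 : ∑ p ∈ S with p < q, ‖β p q‖ * (p : ℝ) ^ (-(1 / 4) : ℝ) ≤
      √(∑ p ∈ S with p < q, ‖β p q‖ ^ 2) *
        √(∑ p ∈ S with p < q, ((p : ℝ) ^ (-(1 / 4) : ℝ)) ^ 2) :=
    Real.sum_mul_le_sqrt_mul_sqrt _ _ _
  have h2 : ∑ p ∈ S with p < q, ‖β p q‖ ^ 2 ≤ ∑ p ∈ S, ‖if p = q then 0 else β p q‖ ^ 2 := by
    calc _ = ∑ p ∈ S with p < q, ‖if p = q then 0 else β p q‖ ^ 2 := by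
          refine Finset.sum_congr rfl fun p hp => ?_
          rw [if_neg (Finset.mem_filter.1 hp).2.ne]
      _ ≤ _ := Finset.sum_le_sum_of_subset_of_nonneg (Finset.filter_subset _ _)
          fun _ _ _ => by positivity
  have h3 : ∑ p ∈ S with p < q, ((p : ℝ) ^ (-(1 / 4) : ℝ)) ^ 2 ≤ 2 * √(q : ℝ) := by
    refine le_trans ?_ (sum_Icc_inv_sqrt_le q)
    calc _ = ∑ p ∈ S with p < q, (√(p : ℝ))⁻¹ := by
          refine Finset.sum_congr rfl fun p _ => ?_
          rw [← Real.rpow_natCast, ← Real.rpow_mul (by positivity), Real.sqrt_eq_rpow,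
            ← Real.rpow_neg (by positivity)]
          norm_num
      _ ≤ _ := Finset.sum_le_sum_of_subset_of_nonneg (fun p hp => by
          have hp' := Finset.mem_filter.1 hp
          exact Finset.mem_Icc.2 ⟨hS p hp'.1, hp'.2.le⟩) fun _ _ _ => by positivity
  have h4 : (q : ℝ) ^ (-(1 / 4) : ℝ) * √(2 * √(q : ℝ)) = √2 := by
    rw [Real.sqrt_mul (by norm_num), Real.sqrt_eq_rpow (√(q : ℝ)), Real.sqrt_eq_rpow (q : ℝ),
      ← Real.rpow_mul hq0.le, mul_left_comm, ← Real.rpow_add hq0]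
    norm_num
  calc _ = (q : ℝ) ^ (-(1 / 4) : ℝ) * ∑ p ∈ S with p < q, ‖β p q‖ * (p : ℝ) ^ (-(1 / 4) : ℝ) := by
        rw [Finset.mul_sum]
        refine Finset.sum_congr rfl fun p _ => ?_
        rw [Nat.cast_mul, Real.mul_rpow (by positivity) (by positivity)]
        ring
    _ ≤ (q : ℝ) ^ (-(1 / 4) : ℝ) * (√(∑ p ∈ S, ‖if p = q then 0 else β p q‖ ^ 2) *
          √(2 * √(q : ℝ))) := by
        gcongr
        refine h1.trans ?_
        gcongr
    _ = _ := by rw [mul_left_comm, h4, mul_comm]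

lemma le_two_cardFactors_cases {n : ℕ} (hn : n ≠ 0) (h : Ω n ≤ 2) :
    n = 1 ∨ n.Prime ∨ (∃ p, p.Prime ∧ n = p ^ 2) ∨
      ∃ p q, p.Prime ∧ q.Prime ∧ p < q ∧ n = p * q := by
  rcases eq_or_ne n 1 with h1 | h1
  · exact Or.inl h1
  obtain ⟨p, hp, m, rfl⟩ := Nat.exists_prime_and_dvd h1
  have hm : m ≠ 0 := right_ne_zero_of_mul hn
  rw [ArithmeticFunction.cardFactors_mul hp.ne_zero hm,
    ArithmeticFunction.cardFactors_apply_prime hp] at h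
  rcases Nat.eq_zero_or_pos (Ω m) with h0 | h0
  · rcases ArithmeticFunction.cardFactors_eq_zero_iff_eq_zero_or_one.1 h0 with h2 | h2
    · exact absurd h2 hm
    · rw [h2, mul_one]
      exact Or.inr (Or.inl hp)
  · have hmp : m.Prime := ArithmeticFunction.cardFactors_eq_one_iff_prime.1 (by omega)
    rcases lt_trichotomy p m with h2 | h2 | h2
    · exact Or.inr (Or.inr (Or.inr ⟨p, m, hp, hmp, h2, rfl⟩))
    · exact Or.inr (Or.inr (Or.inl ⟨p, hp, by rw [← h2, sq]⟩))
    · exact Or.inr (Or.inr (Or.inr ⟨m, p, hmp, hp, h2, mul_comm _ _⟩))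

lemma Finset.sum_union_le_of_nonneg {ι : Type*} [DecidableEq ι] (s t : Finset ι) {f : ι → ℝ}
    (hf : ∀ i, 0 ≤ f i) : ∑ i ∈ s ∪ t, f i ≤ ∑ i ∈ s, f i + ∑ i ∈ t, f i := by
  rw [← Finset.sum_union_inter]
  exact le_add_of_nonneg_right (Finset.sum_nonneg fun i _ => hf i)

/-- A Dirichlet series of homogeneity at most two which converges to a bounded function on a half
plane `Re s > -η` converges absolutely at `1 / 4`. -/
theorem summable_norm_mul_rpow_of_bounded {b : ℕ → ℂ} {η C : ℝ} (hη : 0 < η) (hb0 : b 0 = 0)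
    (hb : ∀ n, 2 < Ω n → b n = 0)
    (hbd : ∀ s : ℂ, -η < s.re → ∃ l, DirichletConvergesTo b s l ∧ ‖l‖ ≤ C) :
    Summable fun n : ℕ => ‖b n‖ * (n : ℝ) ^ (-(1 / 4) : ℝ) := by
  choose! f hf hfC using hbd
  -- The case `e = 1` controls primes and products of two distinct primes; squares of primes do not
  -- occur in that multi-affine polynomial and come from the linear part for `e = 2`.
  have hQ : ∀ e, 1 ≤ e → ∀ S : Finset ℕ, (∀ p ∈ S, p.Prime) → ∀ l : ℕ → ℂ,
      (∀ p, ‖l p‖ ≤ 1 / 2) → ‖quadForm b e S 1 l‖ ≤ C := fun e he S hS l hl =>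
    norm_quadForm_le (F := fun t : ℝ => f (t * Complex.I)) (fun t => hfC _ (by simpa using hη))
      (fun r hr => hasMean_mul_cpow hη hb0 hf hfC hr) hb hl he hS
  set g : ℕ → ℝ := fun n => ‖b n‖ * (n : ℝ) ^ (-(1 / 4) : ℝ) with hg
  have hg0 : ∀ n, 0 ≤ g n := fun n => by positivity
  have hgb : ∀ n, 0 < n → g n ≤ ‖b n‖ := fun n hn =>
    mul_le_of_le_one_right (norm_nonneg _)
      (Real.rpow_le_one_of_one_le_of_nonpos (by exact_mod_cast hn) (by norm_num))
  refine summable_of_sum_range_le (c := ‖b 1‖ + 2 * C + 2 * C + √2 * (9 / 5 * (64 * C))) hg0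
    fun N => ?_
  set S : Finset ℕ := (Finset.range N).filter Nat.Prime
  have hS : ∀ p ∈ S, p.Prime := fun p hp => (Finset.mem_filter.1 hp).2
  have hmemS : ∀ p, p.Prime → p < N → p ∈ S := fun p hp hpN =>
    Finset.mem_filter.2 ⟨Finset.mem_range.2 hpN, hp⟩
  clear_value S
  set P : Finset (ℕ × ℕ) := (S ×ˢ S).filter fun x => x.1 < x.2 with hP
  have hlin : ∀ e, 1 ≤ e → ∑ n ∈ S.image (· ^ e), g n ≤ 2 * C := fun e he =>
    calc ∑ n ∈ S.image (· ^ e), g n ≤ ∑ p ∈ S, g (p ^ e) :=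
          Finset.sum_image_le_of_nonneg fun _ _ => hg0 _
      _ ≤ ∑ p ∈ S, ‖b (p ^ e)‖ := Finset.sum_le_sum fun p hp => hgb _ (pow_pos (hS p hp).pos e)
      _ ≤ 2 * C := sum_norm_linear_le (hQ e he S hS)
  have hquad : ∑ n ∈ P.image (fun x => x.1 * x.2), g n ≤ √2 * (9 / 5 * (64 * C)) :=
    calc _ ≤ ∑ x ∈ P, g (x.1 * x.2) := Finset.sum_image_le_of_nonneg fun _ _ => hg0 _
      _ = ∑ q ∈ S, ∑ p ∈ S with p < q, ‖b (p * q)‖ * ((p * q : ℕ) : ℝ) ^ (-(1 / 4) : ℝ) := by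
          rw [hP, Finset.sum_filter, Finset.sum_product_right]
          exact Finset.sum_congr rfl fun q _ => by rw [Finset.sum_filter]
      _ ≤ _ := sum_lt_mul_rpow_le S (fun p hp => (hS p hp).pos) fun p q => b (p * q)
      _ ≤ _ := by
          gcongr
          exact sum_sqrt_sum_sq_le (hQ 1 le_rfl S hS)
  have hcover : ∑ n ∈ Finset.range N, g n ≤
      ∑ n ∈ (({1} ∪ S.image (· ^ 1)) ∪ S.image (· ^ 2)) ∪ P.image (fun x => x.1 * x.2), g n := by
    rw [← Finset.sum_filter_ne_zero (s := Finset.range N)]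
    refine Finset.sum_le_sum_of_subset_of_nonneg (fun n hn => ?_) fun n _ _ => hg0 n
    obtain ⟨hn, hgn⟩ := Finset.mem_filter.1 hn
    have hnN := Finset.mem_range.1 hn
    have hbn : b n ≠ 0 := fun h => hgn (by simp [hg, h])
    have hn0 : n ≠ 0 := fun h => hbn (h ▸ hb0)
    have hΩ : Ω n ≤ 2 := not_lt.1 fun h => hbn (hb n h)
    have hmem : ∀ p, p.Prime → p ≤ n → p ∈ S := fun p hp hpn => hmemS p hp (by omega)
    simp only [Finset.mem_union, Finset.mem_singleton, Finset.mem_image]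
    rcases le_two_cardFactors_cases hn0 hΩ with h | h | ⟨p, hp, h⟩ | ⟨p, q, hp, hq, hpq, h⟩
    · exact Or.inl (Or.inl (Or.inl h))
    · exact Or.inl (Or.inl (Or.inr ⟨n, hmem n h le_rfl, pow_one n⟩))
    · exact Or.inl (Or.inr ⟨p, hmem p hp (h ▸ Nat.le_self_pow two_ne_zero p), h.symm⟩)
    · refine Or.inr ⟨(p, q), Finset.mem_filter.2 ⟨Finset.mem_product.2 ⟨hmem p hp ?_,
        hmem q hq ?_⟩, hpq⟩, h.symm⟩
      · exact h ▸ Nat.le_mul_of_pos_right p hq.pos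
      · exact h ▸ Nat.le_mul_of_pos_left q hp.pos
  refine hcover.trans ((Finset.sum_union_le_of_nonneg _ _ hg0).trans
    (add_le_add ((Finset.sum_union_le_of_nonneg _ _ hg0).trans
      (add_le_add ((Finset.sum_union_le_of_nonneg _ _ hg0).trans
        (add_le_add ?_ (hlin 1 le_rfl))) (hlin 2 one_le_two))) hquad))
  rw [Finset.sum_singleton]
  exact hgb 1 one_pos

/-- The gap between absolute convergence and boundedness is at most `1 / 4` for Dirichlet series of
homogeneity at most two. -/
theorem abscissaOfAbsConv_le_abscissaOfBoundedness_add {a : ℕ → ℂ}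
    (ha : ∀ n : ℕ, 2 < Ω n → a n = 0) :
    LSeries.abscissaOfAbsConv a ≤ abscissaOfBoundedness a + ((1 / 4 : ℝ) : EReal) := by
  rw [← EReal.sub_le_iff_le_add (by simp) (by simp)]
  refine le_sInf ?_
  rintro _ ⟨σ, ⟨C, hC⟩, rfl⟩
  rw [EReal.sub_le_iff_le_add (by simp) (by simp), ← EReal.coe_add]
  refine LSeries.abscissaOfAbsConv_le_of_forall_lt_LSeriesSummable fun y hy => ?_
  -- Translation by `σ'`, which exceeds `σ`, moves the point `y` to `1 / 4` and leaves a margin `σ'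
  -- - σ > 0` to the left of the imaginary axis.
  set σ' := y - 1 / 4 with hσ'
  set b : ℕ → ℂ := fun n => if n = 0 then 0 else a n * (n : ℂ) ^ (-(σ' : ℂ)) with hbdef
  have hsum := summable_norm_mul_rpow_of_bounded (b := b) (η := σ' - σ) (C := C) (by linarith)
    (by simp [hbdef]) (fun n hn => by simp [hbdef, ha n hn]) (fun s hs => by
      obtain ⟨l, hl, hlC⟩ := hC (s + σ') (by simp; linarith)
      refine ⟨l, hl.congr fun N => Finset.sum_congr rfl fun n hn => ?_, hlC⟩
      have hn0 : n ≠ 0 := by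
        have := (Finset.mem_Icc.1 hn).1
        omega
      simp only [hbdef, if_neg hn0]
      rw [mul_assoc, ← Complex.cpow_add _ _ (by exact_mod_cast hn0)]
      congr 2
      ring)
  refine Summable.of_norm (hsum.congr fun n => ?_)
  rcases Nat.eq_zero_or_pos n with rfl | hn
  · simp [hbdef]
  · rw [LSeries.term_of_ne_zero hn.ne']
    simp only [hbdef, if_neg hn.ne']
    have hn' : (0 : ℝ) < n := by exact_mod_cast hn
    rw [norm_mul, norm_div, Complex.norm_natCast_cpow_of_pos hn,
      Complex.norm_natCast_cpow_of_pos hn, mul_assoc, ← Real.rpow_add hn', div_eq_mul_inv ‖a n‖,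
      ← Real.rpow_neg hn'.le]
    congr 2
    simp [hσ']
    ring

/-! ### The prime numbers and the blocks -/

lemma kthPrime_prime (k : ℕ) : (kthPrime k).Prime := Nat.prime_nth_prime _

lemma kthPrime_lt {k k' : ℕ} (hk : 1 ≤ k) (h : k < k') : kthPrime k < kthPrime k' :=
  (Nat.nth_lt_nth Nat.infinite_setOfPred_prime).2 (by omega)

lemma kthPrime_le {k k' : ℕ} (h : k ≤ k') : kthPrime k ≤ kthPrime k' :=
  (Nat.nth_le_nth Nat.infinite_setOfPred_prime).2 (by omega)

lemma kthPrime_inj {k k' : ℕ} (hk : 1 ≤ k) (hk' : 1 ≤ k') (h : kthPrime k = kthPrime k') :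
    k = k' := by
  have := Nat.nth_injective Nat.infinite_setOfPred_prime h
  omega

lemma lt_kthPrime (k : ℕ) : k < kthPrime k := by
  have := Nat.add_two_le_nth_prime (k - 1)
  unfold kthPrime
  omega

lemma primeCounting_kthPrime {k : ℕ} (hk : 1 ≤ k) : Nat.primeCounting (kthPrime k) = k := by
  rw [Nat.primeCounting_eq_primeCounting'_succ, Nat.primeCounting', Nat.count_succ,
    if_pos (kthPrime_prime k), kthPrime, Nat.count_nth_of_infinite Nat.infinite_setOfPred_prime]
  omega

/-- Chebyshev's lower bound for the number of primes, as an upper bound for the `k`-th prime. -/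
lemma exists_kthPrime_rpow_le {θ : ℝ} (hθ : θ < 1) :
    ∃ C : ℝ, 0 < C ∧ ∀ k : ℕ, 1 ≤ k → (kthPrime k : ℝ) ^ θ ≤ C * k := by
  have hlog2 : 0 < Real.log 2 := Real.log_pos one_lt_two
  have hθ' : 0 < 1 - θ := sub_pos.2 hθ
  refine ⟨3 / ((1 - θ) * Real.log 2), by positivity, fun k hk => ?_⟩
  set P := kthPrime k with hP
  have hP2 : (2 : ℝ) ≤ P := by exact_mod_cast (kthPrime_prime k).two_le
  have hP0 : (0 : ℝ) < P := by linarith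
  have hk1 : (1 : ℝ) ≤ k := by exact_mod_cast hk
  -- The function `ψ (P)` is at least `P log 2` up to a logarithm and at most `π (P) log P = k log
  -- P`; the logarithm is then absorbed in `P ^ (1 - θ)`.
  have h1 := (Chebyshev.psi_ge P).trans (Chebyshev.psi_le_primeCounting_mul_log P)
  rw [hP, primeCounting_kthPrime hk, ← hP] at h1
  have h2 : Real.log (P + 1) ≤ 2 * Real.log P := by
    rw [← Real.log_rpow hP0]
    refine Real.log_le_log (by positivity) ?_
    rw [Real.rpow_two]
    nlinarith
  have h3 : 0 ≤ Real.log P := Real.log_nonneg (by linarith)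
  have h4 : Real.log P ≤ (P : ℝ) ^ (1 - θ) / (1 - θ) := Real.log_le_rpow_div hP0.le hθ'
  have h5 : P * Real.log 2 ≤ 3 * k * ((P : ℝ) ^ (1 - θ) / (1 - θ)) := by
    calc P * Real.log 2 ≤ (k + 2) * Real.log P := by linarith
      _ ≤ 3 * k * Real.log P := by gcongr; linarith
      _ ≤ _ := by gcongr
  have h6 : (P : ℝ) = (P : ℝ) ^ θ * (P : ℝ) ^ (1 - θ) := by
    rw [← Real.rpow_add hP0]
    simp
  have h7 : 0 < (P : ℝ) ^ (1 - θ) := Real.rpow_pos_of_pos hP0 _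
  have h8 : (P : ℝ) ^ θ * ((1 - θ) * Real.log 2) ≤ 3 * k := by
    refine le_of_mul_le_mul_right ?_ h7
    calc _ = (1 - θ) * (((P : ℝ) ^ θ * (P : ℝ) ^ (1 - θ)) * Real.log 2) := by ring
      _ ≤ (1 - θ) * (3 * k * ((P : ℝ) ^ (1 - θ) / (1 - θ))) := by
          rw [← h6]
          gcongr
      _ = _ := by field_simp
  rw [div_mul_eq_mul_div, le_div_iff₀ (by positivity)]
  exact h8

lemma prime_mul_prime_inj {p q p' q' : ℕ} (hp : p.Prime) (hp' : p'.Prime)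
    (hq' : q'.Prime) (h : p < q) (h' : p' < q') (he : p * q = p' * q') : p = p' ∧ q = q' := by
  have h1 : p ∣ p' * q' := he ▸ dvd_mul_right p q
  rcases hp.dvd_mul.1 h1 with h2 | h2
  · have h3 := (Nat.prime_dvd_prime_iff_eq hp hp').1 h2
    subst h3
    exact ⟨rfl, Nat.eq_of_mul_eq_mul_left hp.pos he⟩
  · have h3 := (Nat.prime_dvd_prime_iff_eq hp hq').1 h2
    subst h3
    rw [mul_comm p' p] at he
    have := Nat.eq_of_mul_eq_mul_left hp.pos he
    omega

/-- The first prime index lies in `[2r, 3r)` and the second in `[3r, 4r)` with `r = 2 ^ L`, so the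
factors are ordered and unique factorization recovers both indices; the intervals `[2r, 3r)` are
disjoint for distinct `L`. -/
lemma blockProduct_inj {L i j L' i' j' : ℕ} (hi : i < 2 ^ L) (hj : j < 2 ^ L) (hi' : i' < 2 ^ L')
    (hj' : j' < 2 ^ L') (h : blockProduct L i j = blockProduct L' i' j') :
    L = L' ∧ i = i' ∧ j = j' := by
  have hpos := Nat.two_pow_pos L
  have hpos' := Nat.two_pow_pos L'
  obtain ⟨h1, h2⟩ := prime_mul_prime_inj (kthPrime_prime _) (kthPrime_prime _)
    (kthPrime_prime _) (kthPrime_lt (by omega) (by omega)) (kthPrime_lt (by omega) (by omega)) h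
  have h3 := kthPrime_inj (by omega) (by omega) h1
  have h4 := kthPrime_inj (by omega) (by omega) h2
  have hL : L = L' := by
    rcases lt_trichotomy L L' with hlt | heq | hlt
    · have := Nat.pow_le_pow_right two_pos hlt
      rw [Nat.pow_succ] at this
      omega
    · exact heq
    · have := Nat.pow_le_pow_right two_pos hlt
      rw [Nat.pow_succ] at this
      omega
  subst hL
  omega

lemma lt_blockProduct (L i j : ℕ) : L < blockProduct L i j := by
  have h1 := lt_kthPrime (2 * 2 ^ L + i)
  have h2 := (kthPrime_prime (3 * 2 ^ L + j)).pos
  have h3 : L < 2 ^ L := Nat.lt_two_pow_self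
  calc L < kthPrime (2 * 2 ^ L + i) := by omega
    _ ≤ _ := Nat.le_mul_of_pos_right _ h2

lemma blockProduct_le {L i j : ℕ} (hi : i < 2 ^ L) (hj : j < 2 ^ L) :
    blockProduct L i j ≤ kthPrime (4 * 2 ^ L) ^ 2 := by
  rw [sq]
  exact Nat.mul_le_mul (kthPrime_le (by omega)) (kthPrime_le (by omega))

/-- As `4 * 2 ^ M ≤ 2 * 2 ^ L`, consecutive blocks occupy separate ranges of integers: a cut at
`kthPrime (4 * 2 ^ M) ^ 2` contains exactly the blocks up to `M`. -/
lemma lt_blockProduct_of_lt {L M i j : ℕ} (h : M < L) :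
    kthPrime (4 * 2 ^ M) ^ 2 < blockProduct L i j := by
  have h1 := Nat.pow_le_pow_right two_pos h
  rw [Nat.pow_succ] at h1
  have h2 := Nat.two_pow_pos M
  rw [sq]
  exact Nat.mul_lt_mul_of_le_of_lt (kthPrime_le (by omega)) (kthPrime_lt (by omega) (by omega))
    (kthPrime_prime _).pos

lemma blockProduct_mono_right {L i j j' : ℕ} (h : j ≤ j') :
    blockProduct L i j ≤ blockProduct L i j' :=
  Nat.mul_le_mul_left _ (kthPrime_le (by omega))

/-! ### The Walsh coefficients -/

/-- The weight `β L * 2 ^ (- 3 L / 2)` of the block with number `L`. -/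
noncomputable def blockWeight (β : ℕ → ℂ) (L : ℕ) : ℂ :=
  β L * (((2 : ℝ) ^ (-(3 / 2 : ℝ) * (L : ℝ)) : ℝ) : ℂ)

lemma norm_blockWeight {β : ℕ → ℂ} (hβ : ∀ L, 1 ≤ L → ‖β L‖ = 1) {L : ℕ} (hL : 1 ≤ L) :
    ‖blockWeight β L‖ = ((2 : ℝ) ^ L) ^ (-(3 / 2) : ℝ) := by
  rw [blockWeight, norm_mul, hβ L hL, one_mul, Complex.norm_real, Real.norm_eq_abs,
    abs_of_pos (by positivity), mul_comm, Real.rpow_mul (by norm_num), Real.rpow_natCast]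

lemma exists_of_walshCoeff_ne_zero {β : ℕ → ℂ} {n : ℕ} (h : walshCoeff β n ≠ 0) :
    ∃ L i j : ℕ, 1 ≤ L ∧ i < 2 ^ L ∧ j < 2 ^ L ∧ n = blockProduct L i j := by
  obtain ⟨L, hL, h⟩ := Finset.exists_ne_zero_of_sum_ne_zero h
  obtain ⟨i, hi, h⟩ := Finset.exists_ne_zero_of_sum_ne_zero h
  obtain ⟨j, hj, h⟩ := Finset.exists_ne_zero_of_sum_ne_zero h
  refine ⟨L, i, j, (Finset.mem_Icc.1 hL).1, Finset.mem_range.1 hi, Finset.mem_range.1 hj, ?_⟩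
  by_contra hne
  exact h (if_neg hne)

lemma cardFactors_blockProduct (L i j : ℕ) : Ω (blockProduct L i j) = 2 := by
  rw [blockProduct, ArithmeticFunction.cardFactors_mul (kthPrime_prime _).ne_zero
    (kthPrime_prime _).ne_zero, ArithmeticFunction.cardFactors_apply_prime (kthPrime_prime _),
    ArithmeticFunction.cardFactors_apply_prime (kthPrime_prime _)]

lemma walshCoeff_blockProduct (β : ℕ → ℂ) {L i j : ℕ} (hL : 1 ≤ L) (hi : i < 2 ^ L)
    (hj : j < 2 ^ L) :
    walshCoeff β (blockProduct L i j) = blockWeight β L * walshEntry (2 ^ L) i j := by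
  have hmem : L ∈ Finset.Icc 1 (blockProduct L i j) :=
    Finset.mem_Icc.2 ⟨hL, (lt_blockProduct L i j).le⟩
  have hne : ∀ L' i' j', i' < 2 ^ L' → j' < 2 ^ L' → (L' ≠ L ∨ i' ≠ i ∨ j' ≠ j) →
      blockProduct L i j ≠ blockProduct L' i' j' := fun L' i' j' hi' hj' h heq => by
    have := blockProduct_inj hi hj hi' hj' heq
    omega
  rw [walshCoeff, Finset.sum_eq_single_of_mem L hmem, Finset.sum_eq_single_of_mem i
    (Finset.mem_range.2 hi), Finset.sum_eq_single_of_mem j (Finset.mem_range.2 hj), if_pos rfl,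
    blockWeight]
  · intro j' hj' h
    exact if_neg (hne _ _ _ hi (Finset.mem_range.1 hj') (Or.inr (Or.inr h)))
  · intro i' hi' h
    exact Finset.sum_eq_zero fun j' hj' => if_neg
      (hne _ _ _ (Finset.mem_range.1 hi') (Finset.mem_range.1 hj') (Or.inr (Or.inl h)))
  · intro L' _ h
    exact Finset.sum_eq_zero fun i' hi' => Finset.sum_eq_zero fun j' hj' => if_neg
      (hne _ _ _ (Finset.mem_range.1 hi') (Finset.mem_range.1 hj') (Or.inl h))

/-- The contribution of the block with number `L` to the sum of `walshCoeff β n * g n` over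
`n ≤ N`. -/
noncomputable def blockSum (β : ℕ → ℂ) (g : ℕ → ℂ) (N L : ℕ) : ℂ :=
  blockWeight β L * ∑ i ∈ Finset.range (2 ^ L), ∑ j ∈ Finset.range (2 ^ L),
    if blockProduct L i j ≤ N then walshEntry (2 ^ L) i j * g (blockProduct L i j) else 0

lemma sum_walshCoeff_mul (β g : ℕ → ℂ) (N : ℕ) :
    ∑ n ∈ Finset.Icc 1 N, walshCoeff β n * g n = ∑ L ∈ Finset.Icc 1 N, blockSum β g N L := by
  have h1 : ∀ n ∈ Finset.Icc 1 N, walshCoeff β n * g n =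
      ∑ L ∈ Finset.Icc 1 N, ∑ i ∈ Finset.range (2 ^ L), ∑ j ∈ Finset.range (2 ^ L),
        if n = blockProduct L i j then
          blockWeight β L * (walshEntry (2 ^ L) i j * g (blockProduct L i j)) else 0 := by
    intro n hn
    rw [walshCoeff, Finset.sum_mul]
    rw [Finset.sum_subset (Finset.Icc_subset_Icc_right (Finset.mem_Icc.1 hn).2)]
    · refine Finset.sum_congr rfl fun L _ => ?_
      rw [Finset.sum_mul]
      refine Finset.sum_congr rfl fun i _ => ?_
      rw [Finset.sum_mul]
      refine Finset.sum_congr rfl fun j _ => ?_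
      split_ifs with h
      · rw [← h, blockWeight]
        ring
      · ring
    · intro L hL hL'
      rw [Finset.sum_eq_zero fun i _ => Finset.sum_eq_zero fun j _ => if_neg ?_, zero_mul]
      rintro rfl
      exact hL' (Finset.mem_Icc.2 ⟨(Finset.mem_Icc.1 hL).1, (lt_blockProduct L i j).le⟩)
  rw [Finset.sum_congr rfl h1, Finset.sum_comm]
  refine Finset.sum_congr rfl fun L _ => ?_
  rw [Finset.sum_comm, blockSum, Finset.mul_sum]
  refine Finset.sum_congr rfl fun i _ => ?_
  rw [Finset.sum_comm, Finset.mul_sum]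
  refine Finset.sum_congr rfl fun j _ => ?_
  rw [Finset.sum_ite_eq', mul_ite, mul_zero]
  refine if_congr ?_ rfl rfl
  have := lt_blockProduct L i j
  rw [Finset.mem_Icc]
  omega

/-! ### Bounds for Walsh matrices -/

lemma norm_walshEntry (r i j : ℕ) : ‖walshEntry r i j‖ = 1 := by
  rw [walshEntry, norm_pow, show (2 * Real.pi * Complex.I / r : ℂ) =
    ((2 * Real.pi / r : ℝ) : ℂ) * Complex.I by push_cast; ring, Complex.norm_exp_ofReal_mul_I,
    one_pow]

lemma sum_walshEntry_mul_conj {r : ℕ} (hr : 0 < r) {j k : ℕ} (hj : j < r) (hk : k < r) :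
    ∑ i ∈ Finset.range r, walshEntry r i j * (starRingEnd ℂ) (walshEntry r i k) =
      if j = k then (r : ℂ) else 0 := by
  split_ifs with h
  · subst h
    simp [Complex.mul_conj', norm_walshEntry]
  · have hω := Complex.isPrimitiveRoot_exp r hr.ne'
    set ω := Complex.exp (2 * Real.pi * Complex.I / r) with hωdef
    have hconj : (starRingEnd ℂ) ω = ω⁻¹ := by
      have h1 : ‖ω‖ = 1 := by simpa [walshEntry] using norm_walshEntry r 1 1
      rw [Complex.inv_def, Complex.normSq_eq_norm_sq, h1]
      simp
    have hω0 : ω ≠ 0 := Complex.exp_ne_zero _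
    have hx : ω ^ j * (ω⁻¹) ^ k ≠ 1 := by
      rw [inv_pow]
      intro hx
      rw [mul_inv_eq_one₀ (pow_ne_zero _ hω0)] at hx
      exact h (hω.pow_inj hj hk hx)
    have hsum : ∀ i ∈ Finset.range r,
        walshEntry r i j * (starRingEnd ℂ) (walshEntry r i k) = (ω ^ j * (ω⁻¹) ^ k) ^ i := by
      intro i _
      rw [walshEntry, walshEntry, ← hωdef, map_pow, hconj, mul_pow, ← pow_mul, ← pow_mul,
        mul_comm j, mul_comm k]
    rw [Finset.sum_congr rfl hsum, geom_sum_eq hx, mul_pow, ← pow_mul, ← pow_mul, mul_comm j,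
      mul_comm k, pow_mul, pow_mul, inv_pow, hω.pow_eq_one]
    simp

/-- Parseval: by orthogonality of its columns, the matrix is `√r` times a unitary one. -/
lemma sum_norm_sum_walshEntry_sq {r : ℕ} (hr : 0 < r) (y : ℕ → ℂ) :
    ∑ i ∈ Finset.range r, ‖∑ j ∈ Finset.range r, walshEntry r i j * y j‖ ^ 2 =
      r * ∑ j ∈ Finset.range r, ‖y j‖ ^ 2 := by
  have h : ((∑ i ∈ Finset.range r, ‖∑ j ∈ Finset.range r, walshEntry r i j * y j‖ ^ 2 : ℝ) : ℂ) =
      ((r * ∑ j ∈ Finset.range r, ‖y j‖ ^ 2 : ℝ) : ℂ) := by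
    push_cast
    simp only [← Complex.mul_conj', map_sum, map_mul, Finset.sum_mul_sum]
    rw [Finset.sum_comm, Finset.mul_sum]
    refine Finset.sum_congr rfl fun j hj => ?_
    rw [Finset.sum_comm]
    have h1 : ∀ k ∈ Finset.range r, ∑ i ∈ Finset.range r, walshEntry r i j * y j *
        ((starRingEnd ℂ) (walshEntry r i k) * (starRingEnd ℂ) (y k)) =
        if j = k then r * (y j * (starRingEnd ℂ) (y k)) else 0 := by
      intro k hk
      rw [← zero_mul (y j * (starRingEnd ℂ) (y k)), ← ite_mul,
        ← sum_walshEntry_mul_conj hr (Finset.mem_range.1 hj) (Finset.mem_range.1 hk),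
        Finset.sum_mul]
      exact Finset.sum_congr rfl fun i _ => by ring
    rw [Finset.sum_congr rfl h1, Finset.sum_ite_eq, if_pos hj]
  exact_mod_cast h

/-- The norm of the bilinear form of a Walsh matrix is at most `r ^ (3 / 2)`. -/
lemma norm_sum_sum_walshEntry_le {r : ℕ} (hr : 0 < r) {x y : ℕ → ℂ} {X : ℝ}
    (hx : ∀ i < r, ‖x i‖ ≤ X) (hy : ∀ j < r, ‖y j‖ ≤ 1) :
    ‖∑ i ∈ Finset.range r, ∑ j ∈ Finset.range r, walshEntry r i j * (x i * y j)‖ ≤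
      (r : ℝ) ^ (3 / 2 : ℝ) * X := by
  have hX : 0 ≤ X := (norm_nonneg _).trans (hx 0 hr)
  have hr0 : (0 : ℝ) < r := by exact_mod_cast hr
  have h1 : ∑ i ∈ Finset.range r, ‖∑ j ∈ Finset.range r, walshEntry r i j * y j‖ ≤
      (r : ℝ) ^ (3 / 2 : ℝ) := by
    -- Cauchy–Schwarz against the constant `1` gives `√r * √(r * r)`.
    have h2 := Real.sum_mul_le_sqrt_mul_sqrt (Finset.range r) (fun _ => 1)
      (fun i => ‖∑ j ∈ Finset.range r, walshEntry r i j * y j‖)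
    rw [sum_norm_sum_walshEntry_sq hr] at h2
    have h3 : ∑ j ∈ Finset.range r, ‖y j‖ ^ 2 ≤ r := by
      calc _ ≤ ∑ j ∈ Finset.range r, (1 : ℝ) := by
            refine Finset.sum_le_sum fun j hj => ?_
            exact pow_le_one₀ (norm_nonneg _) (hy j (Finset.mem_range.1 hj))
        _ = r := by simp
    simp only [one_mul, one_pow, Finset.sum_const, Finset.card_range, nsmul_eq_mul, mul_one] at h2
    calc _ ≤ √r * √(r * r) := h2.trans (by gcongr)
      _ = _ := by
        rw [Real.sqrt_mul_self hr0.le, Real.sqrt_eq_rpow]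
        nth_rewrite 2 [← Real.rpow_one (r : ℝ)]
        rw [← Real.rpow_add hr0]
        norm_num
  calc _ ≤ ∑ i ∈ Finset.range r, X * ‖∑ j ∈ Finset.range r, walshEntry r i j * y j‖ := by
        refine norm_sum_le_of_le _ fun i hi => ?_
        have : ∑ j ∈ Finset.range r, walshEntry r i j * (x i * y j) =
            x i * ∑ j ∈ Finset.range r, walshEntry r i j * y j := by
          rw [Finset.mul_sum]
          exact Finset.sum_congr rfl fun j _ => by ring
        rw [this, norm_mul]
        gcongr
        exact hx i (Finset.mem_range.1 hi)
    _ ≤ X * (r : ℝ) ^ (3 / 2 : ℝ) := by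
        rw [← Finset.mul_sum]
        gcongr
    _ = _ := mul_comm _ _

/-- A geometric sum with ratio `x ≠ 1` is at most `2 / ‖x - 1‖`, and Jordan's inequality bounds the
sine in `‖x - 1‖` from below on each half period. The reciprocal of the minimum is relaxed to a sum
of reciprocals, ready for harmonic summation over `i`. -/
lemma norm_sum_walshEntry_le {r i : ℕ} (hi : 1 ≤ i) (hir : i < r) (J : ℕ) :
    ‖∑ j ∈ Finset.range J, walshEntry r i j‖ ≤ r / 2 * ((i : ℝ)⁻¹ + ((r - i : ℕ) : ℝ)⁻¹) := by
  have hr0 : (0 : ℝ) < r := by exact_mod_cast (by omega : 0 < r)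
  have hi0 : (0 : ℝ) < i := by exact_mod_cast hi
  have hd0 : (0 : ℝ) < ((r - i : ℕ) : ℝ) := by exact_mod_cast (by omega : 0 < r - i)
  have hd : ((r - i : ℕ) : ℝ) = r - i := by rw [Nat.cast_sub hir.le]
  set x : ℂ := Complex.exp (2 * Real.pi * Complex.I / r) ^ i with hx
  have hx1 : ‖x‖ = 1 := by rw [hx, ← norm_walshEntry r i 1, walshEntry, mul_one]
  have hxs : ‖x - 1‖ = 2 * |Real.sin (Real.pi * i / r)| := by
    have := Complex.norm_exp_I_mul_ofReal_sub_one (2 * (Real.pi * i / r))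
    rw [mul_div_cancel_left₀ _ (two_ne_zero), norm_mul, Real.norm_eq_abs, Real.norm_eq_abs,
      abs_two] at this
    rw [← this, hx, ← Complex.exp_nat_mul]
    congr 3
    push_cast
    ring
  have hsin : 2 * min (i : ℝ) ((r - i : ℕ) : ℝ) / r ≤ Real.sin (Real.pi * i / r) := by
    have hpi := Real.pi_pos
    rcases le_total (2 * (i : ℝ)) r with h | h
    · have h1 := Real.mul_le_sin (x := Real.pi * i / r) (by positivity) (by
        rw [div_le_div_iff₀ hr0 two_pos]
        nlinarith)
      refine le_trans ?_ h1
      rw [show 2 / Real.pi * (Real.pi * i / r) = 2 * i / r by field_simp]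
      gcongr
      exact min_le_left _ _
    · have h1 := Real.mul_le_sin (x := Real.pi - Real.pi * i / r) (by
        rw [sub_nonneg, div_le_iff₀ hr0]
        have : (i : ℝ) ≤ r := by exact_mod_cast hir.le
        gcongr) (by
        have : Real.pi / 2 ≤ Real.pi * i / r := by
          rw [div_le_div_iff₀ two_pos hr0]
          nlinarith
        linarith)
      rw [Real.sin_pi_sub] at h1
      refine le_trans ?_ h1
      rw [show 2 / Real.pi * (Real.pi - Real.pi * i / r) = 2 * (r - i) / r by field_simp, ← hd]
      gcongr
      exact min_le_right _ _
  have hmin : 0 < min (i : ℝ) ((r - i : ℕ) : ℝ) := lt_min hi0 hd0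
  have hsin0 : 0 < 2 * min (i : ℝ) ((r - i : ℕ) : ℝ) / r := by positivity
  have hne : x ≠ 1 := by
    intro h
    rw [h, sub_self, norm_zero, abs_of_pos (hsin0.trans_le hsin)] at hxs
    linarith
  have hgeom : ∑ j ∈ Finset.range J, walshEntry r i j = (x ^ J - 1) / (x - 1) := by
    rw [← geom_sum_eq hne]
    exact Finset.sum_congr rfl fun j _ => by rw [walshEntry, pow_mul]
  rw [hgeom, norm_div, hxs, abs_of_pos (hsin0.trans_le hsin)]
  have hnum : ‖x ^ J - 1‖ ≤ 2 := by
    refine (norm_sub_le _ _).trans ?_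
    rw [norm_pow, hx1]
    norm_num
  calc _ ≤ 2 / (2 * (2 * min (i : ℝ) ((r - i : ℕ) : ℝ) / r)) := by gcongr
    _ = r / 2 * (min (i : ℝ) ((r - i : ℕ) : ℝ))⁻¹ := by field_simp
    _ ≤ _ := by
      gcongr
      rcases min_choice (i : ℝ) ((r - i : ℕ) : ℝ) with h | h
      · rw [h]
        exact le_add_of_nonneg_right (by positivity)
      · rw [h]
        exact le_add_of_nonneg_left (by positivity)

lemma exists_forall_lt_iff_of_antitone (r : ℕ) {p : ℕ → Prop} (hp : ∀ i j, i ≤ j → p j → p i) :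
    ∃ J ≤ r, ∀ j < r, p j ↔ j < J := by
  induction r with
  | zero => exact ⟨0, le_rfl, by simp⟩
  | succ r ih =>
    by_cases h : p r
    · exact ⟨r + 1, le_rfl, fun j hj => ⟨fun _ => hj, fun _ => hp j r (by omega) h⟩⟩
    · obtain ⟨J, hJ, hJ'⟩ := ih
      refine ⟨J, by omega, fun j hj => ?_⟩
      rcases Nat.lt_succ_iff_lt_or_eq.1 hj with h1 | rfl
      · exact hJ' j h1
      · exact ⟨fun h2 => absurd h2 h, fun h2 => by omega⟩

/-- The sum of a Walsh matrix over the region to the left of a staircase. -/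
lemma norm_sum_staircase_le {r : ℕ} (hr : 0 < r) {J : ℕ → ℕ} (hJ : ∀ i < r, J i ≤ r) :
    ‖∑ i ∈ Finset.range r, ∑ j ∈ Finset.range (J i), walshEntry r i j‖ ≤
      r * (2 + Real.log r) := by
  have h1 : ∀ i ∈ Finset.Ico 1 r, ‖∑ j ∈ Finset.range (J i), walshEntry r i j‖ ≤
      r / 2 * ((i : ℝ)⁻¹ + ((r - i : ℕ) : ℝ)⁻¹) := fun i hi =>
    norm_sum_walshEntry_le (Finset.mem_Ico.1 hi).1 (Finset.mem_Ico.1 hi).2 _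
  -- Row zero consists of ones, so it has no cancellation and is bounded by its length.
  have h0 : ‖∑ j ∈ Finset.range (J 0), walshEntry r 0 j‖ ≤ r := by
    refine (norm_sum_le _ _).trans ?_
    simp only [norm_walshEntry, Finset.sum_const, Finset.card_range, nsmul_eq_mul, mul_one]
    exact_mod_cast hJ 0 hr
  have hrefl : ∑ i ∈ Finset.Ico 1 r, ((r - i : ℕ) : ℝ)⁻¹ = ∑ i ∈ Finset.Ico 1 r, (i : ℝ)⁻¹ := by
    refine Finset.sum_nbij' (fun i => r - i) (fun i => r - i) ?_ ?_ ?_ ?_ ?_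
    · intro i hi
      rw [Finset.mem_Ico] at hi ⊢
      omega
    · intro i hi
      rw [Finset.mem_Ico] at hi ⊢
      omega
    · intro i hi
      rw [Finset.mem_Ico] at hi
      omega
    · intro i hi
      rw [Finset.mem_Ico] at hi
      omega
    · intro i _
      rfl
  have hharm : ∑ i ∈ Finset.Ico 1 r, (i : ℝ)⁻¹ ≤ 1 + Real.log r := by
    refine le_trans ?_ (harmonic_le_one_add_log r)
    rw [harmonic_eq_sum_Icc]
    push_cast
    refine Finset.sum_le_sum_of_subset_of_nonneg (fun i hi => ?_) fun _ _ _ => by positivity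
    rw [Finset.mem_Ico] at hi
    exact Finset.mem_Icc.2 ⟨hi.1, hi.2.le⟩
  rw [Finset.range_eq_Ico, Finset.sum_eq_sum_Ico_succ_bot hr]
  calc _ ≤ (r : ℝ) + ∑ i ∈ Finset.Ico 1 r, r / 2 * ((i : ℝ)⁻¹ + ((r - i : ℕ) : ℝ)⁻¹) :=
        (norm_add_le _ _).trans (add_le_add h0 (norm_sum_le_of_le _ h1))
    _ = r + r * ∑ i ∈ Finset.Ico 1 r, (i : ℝ)⁻¹ := by
        rw [← Finset.mul_sum, Finset.sum_add_distrib, hrefl]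
        ring
    _ ≤ r + r * (1 + Real.log r) := by gcongr
    _ = _ := by ring

/-! ### The abscissae of the Walsh series -/

section WalshSeries

variable {β : ℕ → ℂ}

lemma exists_kthPrime_block_rpow_le {θ : ℝ} (hθ : θ < 1) :
    ∃ C : ℝ, 0 < C ∧ ∀ L : ℕ, (kthPrime (4 * 2 ^ L) : ℝ) ^ θ ≤ C * 2 ^ L := by
  obtain ⟨C, hC, h⟩ := exists_kthPrime_rpow_le hθ
  refine ⟨C * 4, by positivity, fun L => ?_⟩
  have h1 := h (4 * 2 ^ L) (by have := Nat.two_pow_pos L; omega)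
  push_cast at h1
  linarith

lemma norm_blockSum_one_le (hβ : ∀ L, 1 ≤ L → ‖β L‖ = 1) {L : ℕ} (hL : 1 ≤ L) (N : ℕ) :
    ‖blockSum β (fun _ => 1) N L‖ ≤ (2 + L) * ((2 : ℝ) ^ L) ^ (-(1 / 2) : ℝ) := by
  have hu : (0 : ℝ) < 2 ^ L := by positivity
  -- Since `blockProduct` increases with `j`, the condition `blockProduct L i j ≤ N` cuts each row
  -- in an initial segment: a staircase.
  choose J hJ hJ' using fun i => exists_forall_lt_iff_of_antitone (2 ^ L)
    (p := fun j => blockProduct L i j ≤ N) fun j j' h h' => (blockProduct_mono_right h).trans h'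
  have hsum : ∀ i ∈ Finset.range (2 ^ L), ∑ j ∈ Finset.range (2 ^ L),
      (if blockProduct L i j ≤ N then walshEntry (2 ^ L) i j * 1 else 0) =
      ∑ j ∈ Finset.range (J i), walshEntry (2 ^ L) i j := by
    intro i _
    rw [← Finset.sum_filter]
    refine Finset.sum_congr ?_ fun j _ => mul_one _
    ext j
    rw [Finset.mem_filter, Finset.mem_range, Finset.mem_range]
    have := hJ i
    exact ⟨fun h => (hJ' i j h.1).1 h.2, fun h => ⟨by omega, (hJ' i j (by omega)).2 h⟩⟩
  rw [blockSum, norm_mul, norm_blockWeight hβ hL, Finset.sum_congr rfl hsum]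
  have h1 := norm_sum_staircase_le (Nat.two_pow_pos L) (J := J) fun i _ => hJ i
  have h2 : Real.log ((2 ^ L : ℕ) : ℝ) ≤ L := by
    push_cast
    rw [Real.log_pow]
    have := Real.log_two_lt_d9
    have h3 : (0 : ℝ) ≤ L := by positivity
    nlinarith
  calc _ ≤ ((2 : ℝ) ^ L) ^ (-(3 / 2) : ℝ) * (((2 ^ L : ℕ) : ℝ) * (2 + L)) := by
        gcongr
        exact h1.trans (by gcongr)
    _ = (2 + L) * (((2 : ℝ) ^ L) ^ (-(3 / 2) : ℝ) * ((2 : ℝ) ^ L) ^ (1 : ℝ)) := by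
        rw [Real.rpow_one]
        push_cast
        ring
    _ = _ := by
        rw [← Real.rpow_add hu]
        norm_num

lemma blockSum_eq_zero (g : ℕ → ℂ) {N L : ℕ} (h : N ≤ L) : blockSum β g N L = 0 := by
  rw [blockSum, Finset.sum_eq_zero fun i _ => Finset.sum_eq_zero fun j _ => if_neg ?_, mul_zero]
  have := lt_blockProduct L i j
  omega

lemma blockSum_eq_of_le (g : ℕ → ℂ) {N M L : ℕ} (hN : kthPrime (4 * 2 ^ L) ^ 2 ≤ N)
    (hM : kthPrime (4 * 2 ^ L) ^ 2 ≤ M) : blockSum β g N L = blockSum β g M L := by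
  unfold blockSum
  congr 1
  refine Finset.sum_congr rfl fun i hi => Finset.sum_congr rfl fun j hj => ?_
  have := blockProduct_le (Finset.mem_range.1 hi) (Finset.mem_range.1 hj)
  rw [if_pos (this.trans hN), if_pos (this.trans hM)]

lemma sum_walshCoeff_mul_eq_tsum (g : ℕ → ℂ) (N : ℕ) :
    ∑ n ∈ Finset.Icc 1 N, walshCoeff β n * g n = ∑' m, blockSum β g N (m + 1) := by
  rw [sum_walshCoeff_mul, tsum_eq_sum (s := Finset.range N), Finset.range_eq_Ico,
    Finset.sum_Ico_add' (fun L => blockSum β g N L) 0 N 1]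
  · rfl
  · intro m hm
    rw [Finset.mem_range] at hm
    exact blockSum_eq_zero g (by omega)

/-- If the block is not complete at `N`, then `N ^ (θ / 2) ≤ C * 2 ^ L`; raising this to the power
`θ / 2` converts decay in the block size into decay in `N`. -/
lemma two_pow_rpow_neg_le {θ C : ℝ} (hθ : 0 < θ) (hC : 0 < C) {L N : ℕ} (hN : 1 ≤ N)
    (hCL : (kthPrime (4 * 2 ^ L) : ℝ) ^ θ ≤ C * 2 ^ L) (h : N < kthPrime (4 * 2 ^ L) ^ 2) :
    ((2 : ℝ) ^ L) ^ (-(θ / 2)) ≤ C ^ (θ / 2) * (N : ℝ) ^ (-(θ ^ 2 / 4)) := by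
  have hN0 : (0 : ℝ) < N := by exact_mod_cast hN
  have hu : (0 : ℝ) < 2 ^ L := by positivity
  have h1 : (N : ℝ) ^ (θ / 2) ≤ C * 2 ^ L := by
    refine le_trans ?_ hCL
    have h2 : (N : ℝ) ≤ (kthPrime (4 * 2 ^ L) : ℝ) ^ (2 : ℝ) := by
      rw [Real.rpow_two]
      exact_mod_cast h.le
    calc (N : ℝ) ^ (θ / 2) ≤ ((kthPrime (4 * 2 ^ L) : ℝ) ^ (2 : ℝ)) ^ (θ / 2) := by gcongr
      _ = _ := by
        rw [← Real.rpow_mul (by positivity)]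
        congr 1
        ring
  have h3 : (N : ℝ) ^ (θ ^ 2 / 4) ≤ C ^ (θ / 2) * ((2 : ℝ) ^ L) ^ (θ / 2) := by
    rw [← Real.mul_rpow hC.le hu.le]
    calc _ = ((N : ℝ) ^ (θ / 2)) ^ (θ / 2) := by
          rw [← Real.rpow_mul hN0.le]
          congr 1
          ring
      _ ≤ _ := by gcongr
  rw [Real.rpow_neg hu.le, Real.rpow_neg hN0.le, ← div_eq_mul_inv, le_div_iff₀ (by positivity),
    inv_mul_le_iff₀ (by positivity), mul_comm]
  exact h3

/-- The series of the Walsh coefficients converges, with tails `O (n ^ (-θ ^ 2 / 4))`. -/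
lemma exists_walshCoeff_tail_le (hβ : ∀ L, 1 ≤ L → ‖β L‖ = 1) {θ : ℝ} (hθ : 0 < θ) (hθ1 : θ < 1) :
    ∃ (R : ℕ → ℂ) (C : ℝ), (∀ n, 1 ≤ n → walshCoeff β n = R (n - 1) - R n) ∧
      ∀ n, 1 ≤ n → ‖R n‖ ≤ C * (n : ℝ) ^ (-(θ ^ 2 / 4)) := by
  obtain ⟨C, hC, hCL⟩ := exists_kthPrime_block_rpow_le hθ1
  -- The block bound `r ^ (-1/2)` is split as `r ^ (-κ) * r ^ (-θ / 2)`: the first factor pays for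
  -- `2 + L` and the sum over blocks, the second becomes the decay in `N`.
  set κ : ℝ := (1 - θ) / 2 with hκ
  have hκ0 : 0 < κ := by rw [hκ]; linarith
  set ρ : ℝ := 2 ^ (-κ) with hρ
  have hρ0 : 0 < ρ := by positivity
  have hρ1 : ρ < 1 := Real.rpow_lt_one_of_one_lt_of_neg one_lt_two (by linarith)
  have hρL : ∀ L : ℕ, ((2 : ℝ) ^ L) ^ (-κ) = ρ ^ L := fun L => by
    rw [hρ, ← Real.rpow_natCast, ← Real.rpow_natCast, ← Real.rpow_mul (by norm_num),
      ← Real.rpow_mul (by norm_num), mul_comm]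
  have hbase : Summable fun L : ℕ => (2 + (L : ℝ)) * ρ ^ L := by
    have hn : ‖ρ‖ < 1 := by rwa [Real.norm_eq_abs, abs_of_pos hρ0]
    have h1 := (summable_geometric_of_lt_one hρ0.le hρ1).mul_left 2
    have h2 := summable_pow_mul_geometric_of_norm_lt_one 1 hn
    refine (h1.add h2).congr fun L => ?_
    rw [pow_one]
    ring
  set full : ℕ → ℂ := fun L => blockSum β (fun _ => 1) (kthPrime (4 * 2 ^ L) ^ 2) L with hfull
  have hsplit : ∀ L : ℕ, ((2 : ℝ) ^ L) ^ (-(1 / 2) : ℝ) = ρ ^ L * ((2 : ℝ) ^ L) ^ (-(θ / 2)) :=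
    fun L => by
      rw [← hρL, ← Real.rpow_add (by positivity)]
      congr 1
      rw [hκ]
      ring
  have hle : ∀ L N : ℕ, 1 ≤ L →
      ‖blockSum β (fun _ => 1) N L‖ ≤ (2 + L) * ρ ^ L * ((2 : ℝ) ^ L) ^ (-(θ / 2)) :=
    fun L N hL => by
      rw [mul_assoc, ← hsplit]
      exact norm_blockSum_one_le hβ hL N
  have hle1 : ∀ L N : ℕ, 1 ≤ L → ‖blockSum β (fun _ => 1) N L‖ ≤ (2 + L) * ρ ^ L :=
    fun L N hL => by
      refine (hle L N hL).trans (mul_le_of_le_one_right (by positivity) ?_)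
      exact Real.rpow_le_one_of_one_le_of_nonpos (one_le_pow₀ one_le_two) (by linarith)
  have hbase1 : Summable fun m : ℕ => (2 + ((m + 1 : ℕ) : ℝ)) * ρ ^ (m + 1) :=
    (summable_nat_add_iff 1).2 hbase
  have hsfull : Summable fun m => full (m + 1) :=
    Summable.of_norm_bounded hbase1 fun m => hle1 (m + 1) _ (by omega)
  have hspart : ∀ N, Summable fun m => blockSum β (fun _ => 1) N (m + 1) := fun N =>
    Summable.of_norm_bounded hbase1 fun m => hle1 (m + 1) _ (by omega)
  refine ⟨fun N => ∑' m, full (m + 1) - ∑ n ∈ Finset.Icc 1 N, walshCoeff β n,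
    (∑' m : ℕ, (2 + ((m + 1 : ℕ) : ℝ)) * ρ ^ (m + 1)) * (2 * C ^ (θ / 2)), fun n hn => ?_,
    fun N hN => ?_⟩
  · obtain ⟨m, rfl⟩ : ∃ m, n = m + 1 := ⟨n - 1, by omega⟩
    beta_reduce
    rw [Nat.add_sub_cancel, Finset.sum_Icc_succ_top (by omega)]
    ring
  · have h1 := sum_walshCoeff_mul_eq_tsum (β := β) (fun _ => 1) N
    simp only [mul_one] at h1
    beta_reduce
    rw [h1, ← hsfull.tsum_sub (hspart N), mul_assoc, ← tsum_mul_right]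
    refine tsum_of_norm_bounded (hbase1.mul_right _).hasSum fun m => ?_
    -- A block complete at `N` drops out of the tail exactly; only incomplete blocks, for which `N`
    -- is small compared with `r`, leave an error.
    by_cases h : kthPrime (4 * 2 ^ (m + 1)) ^ 2 ≤ N
    · rw [hfull]
      simp only []
      rw [blockSum_eq_of_le _ le_rfl h, sub_self, norm_zero]
      positivity
    · have h2 := two_pow_rpow_neg_le hθ hC hN (hCL (m + 1)) (not_le.1 h)
      have h3 := hle (m + 1) N (by omega)
      have h4 := hle (m + 1) (kthPrime (4 * 2 ^ (m + 1)) ^ 2) (by omega)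
      have h5 : (0 : ℝ) ≤ (2 + ((m + 1 : ℕ) : ℝ)) * ρ ^ (m + 1) := by positivity
      calc _ ≤ 2 * ((2 + ((m + 1 : ℕ) : ℝ)) * ρ ^ (m + 1) * ((2 : ℝ) ^ (m + 1)) ^ (-(θ / 2))) := by
            refine (norm_sub_le _ _).trans ?_
            rw [hfull]
            linarith
        _ ≤ 2 * ((2 + ((m + 1 : ℕ) : ℝ)) * ρ ^ (m + 1) *
              (C ^ (θ / 2) * (N : ℝ) ^ (-(θ ^ 2 / 4)))) := by gcongr
        _ = _ := by ring

lemma exists_dirichletConvergesTo_walshCoeff (hβ : ∀ L, 1 ≤ L → ‖β L‖ = 1) {s : ℂ}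
    (hs : -(1 / 4) < s.re) : ∃ l, DirichletConvergesTo (walshCoeff β) s l := by
  -- The tail exponent for `θ = √c` is `c / 4`, so `c` must lie strictly between `max (-4 * s.re) 0`
  -- and `1`; the midpoint is taken.
  set c : ℝ := (1 + max (-4 * s.re) 0) / 2 with hc
  have hc0 : 0 < c := by
    have := le_max_right (-4 * s.re) 0
    linarith
  have hmax : max (-4 * s.re) 0 < 1 := max_lt (by linarith) one_pos
  have hc1 : c < 1 := by linarith
  have hcs : -4 * s.re < c := by
    have := le_max_left (-4 * s.re) 0
    linarith
  obtain ⟨R, C, h1, h2⟩ := exists_walshCoeff_tail_le hβ (Real.sqrt_pos.2 hc0)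
    (by rw [Real.sqrt_lt' one_pos]; linarith)
  rw [Real.sq_sqrt hc0.le] at h2
  exact exists_dirichletConvergesTo_of_tail_le h1 h2 (by linarith) (by linarith)

lemma abscissaOfConv_walshCoeff_le (hβ : ∀ L, 1 ≤ L → ‖β L‖ = 1) :
    abscissaOfConv (walshCoeff β) ≤ ((-(1 / 4) : ℝ) : EReal) :=
  sInf_le ⟨_, fun _ hs => exists_dirichletConvergesTo_walshCoeff hβ hs, rfl⟩

/-- On a complete block `n ^ (-s)` factors over the two primes, so the Walsh bilinear bound `r ^
(3/2)` cancels the weight. The decay `r ^ (-σ)` comes from the first prime alone, which exceeds `r`.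
-/
lemma norm_blockSum_cpow_le (hβ : ∀ L, 1 ≤ L → ‖β L‖ = 1) {L : ℕ} (hL : 1 ≤ L) {σ : ℝ}
    (hσ : 0 < σ) {s : ℂ} (hs : σ < s.re) {N : ℕ} (hN : kthPrime (4 * 2 ^ L) ^ 2 ≤ N) :
    ‖blockSum β (fun n => (n : ℂ) ^ (-s)) N L‖ ≤ ((2 : ℝ) ^ (-σ)) ^ L := by
  have hu : (0 : ℝ) < 2 ^ L := by positivity
  have hterm : ∀ i ∈ Finset.range (2 ^ L), ∑ j ∈ Finset.range (2 ^ L),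
      (if blockProduct L i j ≤ N then
        walshEntry (2 ^ L) i j * (blockProduct L i j : ℂ) ^ (-s) else 0) =
      ∑ j ∈ Finset.range (2 ^ L), walshEntry (2 ^ L) i j *
        ((kthPrime (2 * 2 ^ L + i) : ℂ) ^ (-s) * (kthPrime (3 * 2 ^ L + j) : ℂ) ^ (-s)) := by
    intro i hi
    refine Finset.sum_congr rfl fun j hj => ?_
    rw [if_pos ((blockProduct_le (Finset.mem_range.1 hi) (Finset.mem_range.1 hj)).trans hN),
      blockProduct, Nat.cast_mul, Complex.natCast_mul_natCast_cpow]
  rw [blockSum, Finset.sum_congr rfl hterm, norm_mul, norm_blockWeight hβ hL]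
  have key := norm_sum_sum_walshEntry_le (Nat.two_pow_pos L)
    (x := fun i => (kthPrime (2 * 2 ^ L + i) : ℂ) ^ (-s))
    (y := fun j => (kthPrime (3 * 2 ^ L + j) : ℂ) ^ (-s)) (X := ((2 : ℝ) ^ L) ^ (-σ)) ?_ ?_
  · calc _ ≤ ((2 : ℝ) ^ L) ^ (-(3 / 2) : ℝ) *
          (((2 ^ L : ℕ) : ℝ) ^ (3 / 2 : ℝ) * ((2 : ℝ) ^ L) ^ (-σ)) := by gcongr
      _ = ((2 : ℝ) ^ L) ^ (-σ) := by
          push_cast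
          rw [← mul_assoc, ← Real.rpow_add hu]
          norm_num
      _ = _ := by
          rw [← Real.rpow_natCast, ← Real.rpow_natCast, ← Real.rpow_mul (by norm_num),
            ← Real.rpow_mul (by norm_num), mul_comm]
  · intro i _
    have h1 := lt_kthPrime (2 * 2 ^ L + i)
    have h2 : (2 : ℝ) ^ L ≤ kthPrime (2 * 2 ^ L + i) := by
      exact_mod_cast (by omega : 2 ^ L ≤ kthPrime (2 * 2 ^ L + i))
    rw [Complex.norm_natCast_cpow_of_pos (by omega), Complex.neg_re]
    calc _ ≤ (kthPrime (2 * 2 ^ L + i) : ℝ) ^ (-σ) :=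
          Real.rpow_le_rpow_of_exponent_le ((one_le_pow₀ one_le_two).trans h2) (by linarith)
      _ ≤ _ := Real.rpow_le_rpow_of_nonpos hu h2 (by linarith)
  · intro j _
    have h1 := (kthPrime_prime (3 * 2 ^ L + j)).pos
    rw [Complex.norm_natCast_cpow_of_pos h1, Complex.neg_re]
    exact Real.rpow_le_one_of_one_le_of_nonpos (by exact_mod_cast h1) (by linarith)

/-- Convergence being known, the limit may be computed along cuts at ends of blocks, where the
complete blocks sum to a geometric series. -/
lemma norm_le_of_dirichletConvergesTo_walshCoeff (hβ : ∀ L, 1 ≤ L → ‖β L‖ = 1) {σ : ℝ}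
    (hσ : 0 < σ) {s : ℂ} (hs : σ < s.re) {l : ℂ} (hl : DirichletConvergesTo (walshCoeff β) s l) :
    ‖l‖ ≤ (1 - (2 : ℝ) ^ (-σ))⁻¹ := by
  have hρ0 : (0 : ℝ) ≤ 2 ^ (-σ) := by positivity
  have hρ1 : (2 : ℝ) ^ (-σ) < 1 := Real.rpow_lt_one_of_one_lt_of_neg one_lt_two (by linarith)
  have hPM : ∀ M, M ≤ kthPrime (4 * 2 ^ M) ^ 2 := fun M => by
    have h1 := lt_kthPrime (4 * 2 ^ M)
    have h2 : M < 2 ^ M := Nat.lt_two_pow_self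
    have h3 := Nat.le_self_pow two_ne_zero (kthPrime (4 * 2 ^ M))
    omega
  have hsub : Tendsto (fun M => kthPrime (4 * 2 ^ M) ^ 2) atTop atTop :=
    tendsto_atTop_mono hPM tendsto_id
  refine le_of_tendsto (hl.comp hsub).norm (Eventually.of_forall fun M => ?_)
  simp only [Function.comp_apply]
  rw [sum_walshCoeff_mul, ← Finset.sum_subset (Finset.Icc_subset_Icc_right (hPM M))]
  · calc _ ≤ ∑ L ∈ Finset.Icc 1 M, ((2 : ℝ) ^ (-σ)) ^ L := by
          refine norm_sum_le_of_le _ fun L hL => ?_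
          rw [Finset.mem_Icc] at hL
          refine norm_blockSum_cpow_le hβ hL.1 hσ hs ?_
          exact Nat.pow_le_pow_left (kthPrime_le (Nat.mul_le_mul_left _
            (Nat.pow_le_pow_right two_pos hL.2))) 2
      _ ≤ ∑' L : ℕ, ((2 : ℝ) ^ (-σ)) ^ L :=
          (summable_geometric_of_lt_one hρ0 hρ1).sum_le_tsum _ fun _ _ => by positivity
      _ = _ := tsum_geometric_of_lt_one hρ0 hρ1
  · intro L hL hL'
    have hML : M < L := by
      rw [Finset.mem_Icc] at hL hL'
      omega
    rw [blockSum, Finset.sum_eq_zero fun i _ => Finset.sum_eq_zero fun j _ => if_neg ?_, mul_zero]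
    exact not_le.2 (lt_blockProduct_of_lt hML)

lemma abscissaOfBoundedness_walshCoeff_le (hβ : ∀ L, 1 ≤ L → ‖β L‖ = 1) :
    abscissaOfBoundedness (walshCoeff β) ≤ 0 := by
  refine EReal.le_of_forall_lt_iff_le.1 fun σ hσ => sInf_le ⟨σ, ?_, rfl⟩
  have hσ0 : 0 < σ := by exact_mod_cast hσ
  refine ⟨(1 - (2 : ℝ) ^ (-σ))⁻¹, fun s hs => ?_⟩
  obtain ⟨l, hl⟩ := exists_dirichletConvergesTo_walshCoeff hβ (s := s) (by linarith)
  exact ⟨l, hl, norm_le_of_dirichletConvergesTo_walshCoeff hβ hσ0 hs hl⟩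

/-- At a point `y < 1 / 4`, the `r ^ 2` terms of one block, each at least `r ^ (-3/2) * P ^ (-2y)`
with `P` the `4r`-th prime, already have an unbounded sum as `r` grows. -/
lemma le_abscissaOfAbsConv_walshCoeff (hβ : ∀ L, 1 ≤ L → ‖β L‖ = 1) :
    ((1 / 4 : ℝ) : EReal) ≤ LSeries.abscissaOfAbsConv (walshCoeff β) := by
  by_contra! hlt
  obtain ⟨x, hx, hx4⟩ := EReal.exists_between_coe_real hlt
  rw [EReal.coe_lt_coe_iff] at hx4
  set y : ℝ := max x (1 / 8) with hy
  have hy0 : 0 < y := lt_of_lt_of_le (by norm_num) (le_max_right x (1 / 8))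
  have hy4 : y < 1 / 4 := max_lt hx4 (by norm_num)
  have hsum : LSeriesSummable (walshCoeff β) (y : ℂ) :=
    LSeriesSummable_of_abscissaOfAbsConv_lt_re (hx.trans_le (by
      rw [Complex.ofReal_re]
      exact_mod_cast le_max_left x (1 / 8)))
  replace hsum := hsum.norm
  set g : ℕ → ℝ := fun n => ‖LSeries.term (walshCoeff β) y n‖ with hg
  -- Both `θ < 1`, needed for Chebyshev's bound, and `2 * y / θ < 1 / 2`, needed for growth, amount
  -- to `y < 1 / 4`.
  set θ : ℝ := 1 / 2 + 2 * y with hθ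
  obtain ⟨C, hC, hCL⟩ := exists_kthPrime_block_rpow_le (θ := θ) (by linarith)
  have hθ0 : 0 < θ := by linarith
  set μ : ℝ := 2 * y / θ with hμ
  have hμ2 : μ < 1 / 2 := by
    rw [hμ, div_lt_iff₀ hθ0]
    linarith
  have hbound : ∀ L : ℕ, 1 ≤ L → ((2 : ℝ) ^ L) ^ (1 / 2 - μ) ≤ C ^ μ * ∑' n, g n := by
    intro L hL
    set u : ℝ := 2 ^ L with hu
    have hu0 : 0 < u := by positivity
    set P : ℝ := (kthPrime (4 * 2 ^ L) : ℝ) with hP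
    have hP0 : 0 < P := by
      rw [hP]
      exact_mod_cast (kthPrime_prime _).pos
    have hterm : ∀ i < 2 ^ L, ∀ j < 2 ^ L,
        u ^ (-(3 / 2) : ℝ) * P ^ (-(2 * y)) ≤ g (blockProduct L i j) := by
      intro i hi j hj
      have hb0 : 0 < blockProduct L i j := (Nat.zero_le _).trans_lt (lt_blockProduct L i j)
      have hb0' : (0 : ℝ) < blockProduct L i j := by exact_mod_cast hb0
      rw [hg]
      simp only []
      rw [LSeries.term_of_ne_zero hb0.ne', walshCoeff_blockProduct β hL hi hj, norm_div, norm_mul,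
        norm_walshEntry, mul_one, norm_blockWeight hβ hL, Complex.norm_natCast_cpow_of_pos hb0,
        Complex.ofReal_re, div_eq_mul_inv (_ ^ _) (_ ^ y), ← Real.rpow_neg hb0'.le]
      gcongr
      have h1 : (blockProduct L i j : ℝ) ≤ P ^ (2 : ℝ) := by
        rw [Real.rpow_two, hP]
        exact_mod_cast blockProduct_le hi hj
      calc P ^ (-(2 * y)) = (P ^ (2 : ℝ)) ^ (-y) := by
            rw [← Real.rpow_mul hP0.le]
            congr 1
            ring
        _ ≤ _ := Real.rpow_le_rpow_of_nonpos hb0' h1 (by linarith)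
    have hblock : u * u * (u ^ (-(3 / 2) : ℝ) * P ^ (-(2 * y))) ≤ ∑' n, g n := by
      have hinj : Set.InjOn (fun x : ℕ × ℕ => blockProduct L x.1 x.2)
          (Finset.range (2 ^ L) ×ˢ Finset.range (2 ^ L) : Finset (ℕ × ℕ)) := by
        rintro ⟨i, j⟩ hx ⟨i', j'⟩ hx' h
        simp only [Finset.coe_product, Finset.coe_range, Set.mem_prod, Set.mem_Iio] at hx hx'
        obtain ⟨_, h1, h2⟩ := blockProduct_inj hx.1 hx.2 hx'.1 hx'.2 h
        rw [h1, h2]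
      calc _ = ∑ _x ∈ Finset.range (2 ^ L) ×ˢ Finset.range (2 ^ L),
            u ^ (-(3 / 2) : ℝ) * P ^ (-(2 * y)) := by
            rw [Finset.sum_const, Finset.card_product, Finset.card_range, nsmul_eq_mul]
            push_cast
            rfl
        _ ≤ ∑ x ∈ Finset.range (2 ^ L) ×ˢ Finset.range (2 ^ L), g (blockProduct L x.1 x.2) := by
            refine Finset.sum_le_sum fun x hx => ?_
            rw [Finset.mem_product, Finset.mem_range, Finset.mem_range] at hx
            exact hterm _ hx.1 _ hx.2
        _ = ∑ n ∈ (Finset.range (2 ^ L) ×ˢ Finset.range (2 ^ L)).image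
              (fun x : ℕ × ℕ => blockProduct L x.1 x.2), g n := (Finset.sum_image hinj).symm
        _ ≤ _ := hsum.sum_le_tsum _ fun _ _ => norm_nonneg _
    have hPu : P ^ (2 * y) ≤ C ^ μ * u ^ μ := by
      rw [← Real.mul_rpow hC.le hu0.le]
      calc P ^ (2 * y) = (P ^ θ) ^ μ := by
            rw [← Real.rpow_mul hP0.le, hμ, mul_div_cancel₀ _ hθ0.ne']
        _ ≤ _ := by
            have := hCL L
            gcongr
    have hT0 : 0 ≤ ∑' n, g n := tsum_nonneg fun _ => norm_nonneg _
    have h5 : u ^ (1 / 2 : ℝ) ≤ P ^ (2 * y) * ∑' n, g n := by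
      have h6 : u * u * u ^ (-(3 / 2) : ℝ) = u ^ (1 / 2 : ℝ) := by
        nth_rewrite 1 2 [← Real.rpow_one u]
        rw [← Real.rpow_add hu0, ← Real.rpow_add hu0]
        norm_num
      rw [← mul_assoc, h6, Real.rpow_neg hP0.le, ← div_eq_mul_inv,
        div_le_iff₀ (by positivity)] at hblock
      linarith
    rw [Real.rpow_sub hu0, div_le_iff₀ (by positivity)]
    calc _ ≤ P ^ (2 * y) * ∑' n, g n := h5
      _ ≤ (C ^ μ * u ^ μ) * ∑' n, g n := by gcongr
      _ = _ := by ring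
  have htend : Tendsto (fun L : ℕ => ((2 : ℝ) ^ L) ^ (1 / 2 - μ)) atTop atTop :=
    (tendsto_rpow_atTop (by linarith)).comp (tendsto_pow_atTop_atTop_of_one_lt one_lt_two)
  obtain ⟨L, hL1, hL⟩ := ((eventually_ge_atTop 1).and
    (htend.eventually_gt_atTop (C ^ μ * ∑' n, g n))).exists
  exact absurd (hbound L hL1) (not_le.2 hL)

end WalshSeries

theorem mainTheorem1 :
    (∀ β : ℕ → ℂ, (∀ L : ℕ, 1 ≤ L → ‖β L‖ = 1) →
      -- the coefficients
      (∀ L i j : ℕ, 1 ≤ L → i < 2 ^ L → j < 2 ^ L →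
        walshCoeff β (blockProduct L i j) =
          β L * (((2 : ℝ) ^ (-(3 / 2 : ℝ) * (L : ℝ)) : ℝ) : ℂ) * walshEntry (2 ^ L) i j) ∧
      (∀ n : ℕ, walshCoeff β n ≠ 0 →
        ∃ L i j : ℕ, 1 ≤ L ∧ i < 2 ^ L ∧ j < 2 ^ L ∧ n = blockProduct L i j) ∧
      -- homogeneity two
      (∀ n : ℕ, walshCoeff β n ≠ 0 → Ω n = 2) ∧
      -- the abscissae
      abscissaOfBoundedness (walshCoeff β) = 0 ∧
      ((1 / 4 : ℝ) : EReal) ≤ LSeries.abscissaOfAbsConv (walshCoeff β) ∧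
      abscissaOfConv (walshCoeff β) ≤ ((-(1 / 4) : ℝ) : EReal) ∧
      -- the gaps
      LSeries.abscissaOfAbsConv (walshCoeff β) - abscissaOfBoundedness (walshCoeff β)
        = ((1 / 4 : ℝ) : EReal) ∧
      ((1 / 4 : ℝ) : EReal)
        ≤ abscissaOfBoundedness (walshCoeff β) - abscissaOfConv (walshCoeff β)) ∧
    -- optimality of the gap `1 / 4` for series of homogeneity at most two
    (∀ a : ℕ → ℂ, (∀ n : ℕ, 2 < Ω n → a n = 0) →
      LSeries.abscissaOfAbsConv a ≤ abscissaOfBoundedness a + ((1 / 4 : ℝ) : EReal)) := by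
  refine ⟨fun β hβ => ?_, fun a ha => abscissaOfAbsConv_le_abscissaOfBoundedness_add ha⟩
  have hΩ : ∀ n : ℕ, walshCoeff β n ≠ 0 → Ω n = 2 := fun n hn => by
    obtain ⟨L, i, j, _, _, _, rfl⟩ := exists_of_walshCoeff_ne_zero hn
    exact cardFactors_blockProduct L i j
  have hopt := abscissaOfAbsConv_le_abscissaOfBoundedness_add (a := walshCoeff β) fun n hn => by
    by_contra h
    have := hΩ n h
    omega
  have ha := le_abscissaOfAbsConv_walshCoeff hβ
  have hc := abscissaOfConv_walshCoeff_le hβ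
  -- The lower bound for `σ_b` comes from optimality: `1 / 4 ≤ σ_a ≤ σ_b + 1 / 4`.
  have hb : abscissaOfBoundedness (walshCoeff β) = 0 := by
    refine le_antisymm (abscissaOfBoundedness_walshCoeff_le hβ) ?_
    have h1 := EReal.sub_le_of_le_add (ha.trans hopt)
    rwa [← EReal.coe_sub, sub_self, EReal.coe_zero] at h1
  have ha' : LSeries.abscissaOfAbsConv (walshCoeff β) = ((1 / 4 : ℝ) : EReal) :=
    le_antisymm (by rwa [hb, zero_add] at hopt) ha
  refine ⟨fun L i j hL hi hj => walshCoeff_blockProduct β hL hi hj,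
    fun n hn => exists_of_walshCoeff_ne_zero hn, hΩ, hb, ha, hc, ?_, ?_⟩
  · rw [ha', hb, sub_zero]
  · rw [hb, zero_sub]
    have := EReal.neg_le_neg_iff.2 hc
    rwa [← EReal.coe_neg, neg_neg] at this
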